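/- Let $q$ be a power of a prime, $A=\mathbb F_q[\theta]$, $k=\mathbb F_q(\theta)$, and let $A_+\subset A$ be the set of monic polynomials. Put $D_i=\prod_{j=0}^{i-1}(\theta^{q^i}-\theta^{q^j})$ and $L_i=\prod_{j=1}^{i}(\theta-\theta^{q^j})$ (so $D_0=L_0=1$). For $n=\sum_i n_iq^i\ge 0$ with $0\le n_i\le q-1$ put $\Pi(n)=\Gamma_{n+1}=\prod_i D_i^{n_i}$. Let $e_C(z)=\sum_{i\ge0}z^{q^i}/D_i$ and define the Bernoulli–Carlitz numbers $BC_n\in k$ by $\sum_{n\ge0}BC_n\frac{z^n}{\Pi(n)}=\frac{z}{e_C(z)}$. The Anderson–Thakur polynomials $H_n\in A[t]$ are defined by $$\Bigl(1-\sum_{i\ge0}\frac{\prod_{j=1}^{i}(t^{q^i}-\theta^{q^j})}{D_i|_{\theta=t}}x^{q^i}\Bigr)^{-1}=\sum_{n\ge0}\frac{H_n}{\Gamma_{n+1}|_{\theta=t}}x^n .$$ For $r\ge1$ and $\mathfrak s=(s_1,\dots,s_r)$ with integers $s_i\ge1$, write $H_{s_i-1}=\sum_{j=0}^{m_i}u_{ij}t^j$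 with $u_{ij}\in A$ and $u_{im_i}\neq0$, put $J_{\mathfrak s}=\prod_{i=1}^r\{0,1,\dots,m_i\}$, and for $\mathbf j=(j_1,\dots,j_r)\in J_{\mathfrak s}$ put $|\mathbf j|=j_1+\cdots+j_r$. Let $$Li_{\mathfrak s}(z_1,\dots,z_r)=\sum_{i_1>\cdots>i_r\ge0}\frac{z_1^{q^{i_1}}\cdots z_r^{q^{i_r}}}{L_{i_1}^{s_1}\cdots L_{i_r}^{s_r}},$$ and define the multi-poly-Bernoulli–Carlitz numbers $BC_n^{\mathfrak s,\mathbf j}\in k$ by $$\sum_{n\ge0}BC^{\mathfrak s,\mathbf j}_n\frac{z^n}{\Pi(n)}=\frac{Li_{\mathfrak s}(e_C(z)u_{1j_1},u_{2j_2},\dots,u_{rj_r})}{e_C(z)} .$$ For a monic irreducible $\wp\in A$ and any tuple $\mathfrak s=(s_1,\dots,s_r)$ of positive integers, the $\wp$-component of the finite multiple zeta value is $$\zeta_{\mathscr A_k}(\mathfrak s)_\wp=\sum_{\substack{a_1,\dots,a_r\in A_+\\ \deg\wp>\deg a_1>\cdots>\deg a_r\ge0}}\frac1{a_1^{s_1}\cdots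 a_r^{s_r}}\in A/\wp A .$$ **Theorem.** Let $r\ge 1$, let $\mathfrak s=(s_1,\dots,s_r)$ be a tuple of positive integers, and let $\wp\in A$ be a monic irreducible polynomial with $\wp\nmid\Gamma_{s_1}\cdots\Gamma_{s_r}$. Then the right-hand sides below are $\wp$-integral elements of $k$, and $$\zeta_{\mathscr A_k}(\mathfrak s)_\wp\equiv\frac1{\Gamma_{s_1}\cdots\Gamma_{s_r}}\sum_{\mathbf j\in J_{\mathfrak s}}\theta^{|\mathbf j|}\sum_{i=r-1}^{\deg\wp-1}\frac1{L_i}\,\frac{BC^{\mathfrak s,\mathbf j}_{q^i-1}}{BC_{q^i-1}}\pmod\wp ,$$ and, more generally, for every $d\ge0$, $$\zeta_{\mathscr A_k}(\underbrace{1,\dots,1}_{d},s_1,\dots,s_r)_\wp\equiv\frac1{\Gamma_{s_1}\cdots\Gamma_{s_r}}\sum_{\mathbf j\in J_{\mathfrak s}}\theta^{|\mathbf j|}\sum_{\deg\wp>i_0>\cdots>i_d\ge r-1}\frac1{L_{i_0}\cdots L_{i_d}}\,\frac{BC^{\mathfrak s,\mathbf j}_{q^{i_d}-1}}{BC_{q^{i_d}-1}}\pmod\wp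 .$$ Empty sums are $0$. -/

import Mathlib

open scoped Polynomial PowerSeries LaurentSeries

noncomputable section

namespace Carlitz

/-! Throughout, `F` is the finite field with `q` elements, `A = F[θ]` is `F[X]`, and
`k = F(θ)` is `RatFunc F`. -/

section Basic

variable (F : Type*) [Field F] [Fintype F]

/-- `D_i = ∏_{j=0}^{i-1} (θ^{q^i} - θ^{q^j})`. -/
def D (i : ℕ) : F[X] :=
  ∏ j ∈ Finset.range i,
    ((Polynomial.X : F[X]) ^ (Fintype.card F ^ i) - Polynomial.X ^ (Fintype.card F ^ j))

/-- `L_i = ∏_{j=1}^{i} (θ - θ^{q^j})`. -/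
def L (i : ℕ) : F[X] :=
  ∏ j ∈ Finset.Icc 1 i,
    ((Polynomial.X : F[X]) - Polynomial.X ^ (Fintype.card F ^ j))

/-- The Carlitz factorial `Π(n) = ∏_i D_i^{n_i}`, where `n = ∑_i n_i q^i` with
`0 ≤ n_i ≤ q - 1`; the digit `n_i = ⌊n / q^i⌋ mod q` vanishes for `i > n`. -/
def factorial (n : ℕ) : F[X] :=
  ∏ i ∈ Finset.range (n + 1), D F i ^ (n / Fintype.card F ^ i % Fintype.card F)

/-- The Carlitz gamma `Γ_s = Π(s - 1)`, for `s ≥ 1`. -/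
def Gamma (s : ℕ) : F[X] := factorial F (s - 1)

/-- The power series `∑_{i ≥ 0} c_i x^{q^i}` (the coefficient of `x^n` is `c_i` if `n = q^i`, which
forces `i ≤ n`, and `0` if `n` is not a power of `q`). -/
def frobSeries {K : Type*} [Field K] (c : ℕ → K) : K⟦X⟧ :=
  PowerSeries.mk fun n =>
    ∑ i ∈ Finset.range (n + 1), if n = Fintype.card F ^ i then c i else 0

/-- The Carlitz exponential `e_C(z) = ∑_{i ≥ 0} z^{q^i} / D_i`. -/
def expC : (RatFunc F)⟦X⟧ :=
  frobSeries F fun i => (algebraMap F[X] (RatFunc F) (D F i))⁻¹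

/-- The Bernoulli-Carlitz numbers: `∑_{n ≥ 0} BC_n z^n / Π(n) = z / e_C(z)`, the quotient being
taken in the field of Laurent series. -/
def BC (n : ℕ) : RatFunc F :=
  algebraMap F[X] (RatFunc F) (factorial F n) *
    HahnSeries.coeff (((PowerSeries.X : (RatFunc F)⟦X⟧) : (RatFunc F)⸨X⸩) /
      ((expC F : (RatFunc F)⟦X⟧) : (RatFunc F)⸨X⸩)) (n : ℤ)

/-! ### Anderson-Thakur polynomials

In `A[t] = F[X][X]` the outer variable is `t` and the inner variable is `θ`; for `a ∈ A`, the
element `a|_{θ = t}` is `a.map Polynomial.C`. -/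

/-- The coefficient of `x^n` in
`(1 - ∑_{i ≥ 0} (∏_{j=1}^{i} (t^{q^i} - θ^{q^j}) / D_i|_{θ=t}) x^{q^i})⁻¹`,
an element of the fraction field of `A[t]`. -/
def atCoeff (n : ℕ) : FractionRing F[X][X] :=
  PowerSeries.coeff n
    ((1 - frobSeries F fun i =>
      algebraMap F[X][X] (FractionRing F[X][X])
        (∏ j ∈ Finset.Icc 1 i,
          ((Polynomial.X : F[X][X]) ^ (Fintype.card F ^ i) -
            Polynomial.C (Polynomial.X ^ (Fintype.card F ^ j)))) /
      algebraMap F[X][X] (FractionRing F[X][X])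
        ((D F i).map Polynomial.C))⁻¹ : (FractionRing F[X][X])⟦X⟧)

open Classical in
/-- The Anderson-Thakur polynomial `H_n ∈ A[t]`: the (unique) polynomial such that
`H_n / Γ_{n+1}|_{θ=t}` is the coefficient of `x^n` in the generating series. (The value `0` in
the absence of such a polynomial is never taken.) -/
def H (n : ℕ) : F[X][X] :=
  if h : ∃ p : F[X][X],
      algebraMap F[X][X] (FractionRing F[X][X]) p /
        algebraMap F[X][X] (FractionRing F[X][X]) ((Gamma F (n + 1)).map Polynomial.C) =
      atCoeff F n
  then h.choose else 0

end Basic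

section Multi

variable {F : Type*} [Field F] [Fintype F] {r : ℕ}

/-- The coefficient `u_{ij} ∈ A` of `t^j` in `H_{s_i - 1}`. -/
def u (s : Fin r → ℕ) (i : Fin r) (j : ℕ) : F[X] := (H F (s i - 1)).coeff j

variable (F) in
/-- `J_s = {0, …, m_1} × ⋯ × {0, …, m_r}`, where `m_i` is the degree of `H_{s_i - 1}` in `t`. -/
def J (s : Fin r → ℕ) : Finset (Fin r → ℕ) :=
  Fintype.piFinset fun i => Finset.range ((H F (s i - 1)).natDegree + 1)

/-- The Carlitz multiple polylogarithm
`Li_s(w_1, …, w_r) = ∑_{i_1 > ⋯ > i_r ≥ 0} w_1^{q^{i_1}} ⋯ w_r^{q^{i_r}} / (L_{i_1}^{s_1} ⋯ L_{i_r}^{s_r})`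
at power series `w_1, …, w_r` in one variable `z`, summed coefficientwise. For `r ≥ 1` and `w_1`
without constant term, only finitely many terms contribute to each coefficient. -/
def Li (s : Fin r → ℕ) (w : Fin r → (RatFunc F)⟦X⟧) : (RatFunc F)⟦X⟧ :=
  PowerSeries.mk fun n =>
    ∑ᶠ i : {i : Fin r → ℕ // StrictAnti i},
      PowerSeries.coeff n (∏ l, (w l ^ (Fintype.card F ^ i.1 l) *
        PowerSeries.C (((algebraMap F[X] (RatFunc F) (L F (i.1 l))) ^ s l)⁻¹)))

/-- The multi-poly-Bernoulli-Carlitz numbers: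
`∑_{n ≥ 0} BC_n^{s,j} z^n / Π(n) = Li_s(e_C(z) u_{1 j_1}, u_{2 j_2}, …, u_{r j_r}) / e_C(z)`. -/
def multiBC (s j : Fin r → ℕ) (n : ℕ) : RatFunc F :=
  algebraMap F[X] (RatFunc F) (factorial F n) *
    HahnSeries.coeff
      (((Li s fun l =>
          (if (l : ℕ) = 0 then expC F else 1) *
            PowerSeries.C (algebraMap F[X] (RatFunc F) (u s l (j l))) : (RatFunc F)⟦X⟧) :
          (RatFunc F)⸨X⸩) /
        ((expC F : (RatFunc F)⟦X⟧) : (RatFunc F)⸨X⸩)) (n : ℤ)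

/-- The tuples `(a_1, …, a_r)` of monic polynomials with
`deg P > deg a_1 > ⋯ > deg a_r ≥ 0`. -/
def monicTuples (r : ℕ) (P : F[X]) : Set (Fin r → F[X]) :=
  {a | (∀ i, (a i).Monic ∧ (a i).natDegree < P.natDegree) ∧
    StrictAnti fun i => (a i).natDegree}

/-- The `P`-component of the finite multiple zeta value:
`∑ 1 / (a_1^{s_1} ⋯ a_r^{s_r}) ∈ A / P A` over monic `a_1, …, a_r` with
`deg P > deg a_1 > ⋯ > deg a_r ≥ 0`. For `P` irreducible all these denominators are units. -/
def finiteMZV (s : Fin r → ℕ) (P : F[X]) : F[X] ⧸ Ideal.span {P} :=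
  ∑ᶠ a ∈ monicTuples r P, Ring.inverse (Ideal.Quotient.mk (Ideal.span {P}) (∏ i, a i ^ s i))

open Classical in
/-- The tuples `(i_0, …, i_{n-1})` of integers with `b > i_0 > ⋯ > i_{n-1} ≥ a`. -/
def decTuples (n a b : ℕ) : Finset (Fin n → ℕ) :=
  (Fintype.piFinset fun _ => Finset.Ico a b).filter fun i => StrictAnti i

/-- `x mod P = y`: the element `x` of `k` is integral at `P`, that is `x = a / b` with `a, b ∈ A`
and `P ∤ b`, and its residue class `a / b` in `A / P A` is `y`. -/
def HasResidue (P : F[X]) (x : RatFunc F) (y : F[X] ⧸ Ideal.span {P}) : Prop :=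
  ∃ a b : F[X], ¬ P ∣ b ∧
    x = algebraMap F[X] (RatFunc F) a / algebraMap F[X] (RatFunc F) b ∧
    y * Ideal.Quotient.mk (Ideal.span {P}) b = Ideal.Quotient.mk (Ideal.span {P}) a

/-- The residue class is unique. -/
theorem HasResidue.unique {P : F[X]} (hP : Irreducible P) {x : RatFunc F}
    {y y' : F[X] ⧸ Ideal.span {P}} (h : HasResidue P x y) (h' : HasResidue P x y') : y = y' := by
  obtain ⟨a, b, hb, hx, hy⟩ := h
  obtain ⟨a', b', hb', hx', hy'⟩ := h'
  have hb0 : b ≠ 0 := fun e => hb (e ▸ dvd_zero P)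
  have hb0' : b' ≠ 0 := fun e => hb' (e ▸ dvd_zero P)
  have inj := IsFractionRing.injective F[X] (RatFunc F)
  have e : a * b' = a' * b := by
    rw [hx, div_eq_div_iff (by simpa using hb0) (by simpa using hb0')] at hx'
    apply inj
    simpa using hx'
  have hp : Prime P := hP.prime
  obtain ⟨y, rfl⟩ := Ideal.Quotient.mk_surjective y
  obtain ⟨y', rfl⟩ := Ideal.Quotient.mk_surjective y'
  rw [← map_mul, Ideal.Quotient.eq, Ideal.mem_span_singleton] at hy hy'
  rw [Ideal.Quotient.eq, Ideal.mem_span_singleton]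
  have key : P ∣ (y - y') * (b * b') := by
    have e2 : (y - y') * (b * b') = (y * b - a) * b' - (y' * b' - a') * b := by
      linear_combination e
    rw [e2]
    exact dvd_sub (hy.mul_right _) (hy'.mul_right _)
  rcases hp.dvd_or_dvd key with h | h
  · exact h
  · exact ((hp.dvd_or_dvd h).elim hb hb').elim

/-- The sum defining `finiteMZV` is finite. -/
theorem finite_monicTuples (r : ℕ) (P : F[X]) : (monicTuples r P).Finite := by
  have hfin : {p : F[X] | p.natDegree < P.natDegree}.Finite := by
    have : Finite (Polynomial.degreeLT F P.natDegree) :=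
      Finite.of_equiv _ (Polynomial.degreeLTEquiv F P.natDegree).toEquiv.symm
    refine (Set.toFinite (Polynomial.degreeLT F P.natDegree : Set F[X])).subset fun p hp => ?_
    simp only [SetLike.mem_coe, Polynomial.mem_degreeLT]
    exact lt_of_le_of_lt Polynomial.degree_le_natDegree (by exact_mod_cast hp)
  exact (Set.Finite.pi' fun _ : Fin r => hfin).subset fun a ha i => (ha.1 i).2

end Multi

end Carlitz

end

/-! The congruence is the reduction of an identity in k. The right-hand side equals `truncMZV`, the
sum of S_{i_1}(s_1)⋯S_{i_r}(s_r) over deg ℘ > i_1 > ⋯ > i_r ≥ 0, where S_d(s) is the sum of a^{-s}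
over monic a of degree d. Only polynomials prime to ℘ occur in its denominators, so its residue is
the finite zeta value (`hasResidue_truncMZV`).

Two facts give the identity. First, z = log_C(e_C(z)) and the polylogarithm are both of the form ∑
c_m e_C^{q^m}. The coefficient of z^{q^i-1} in e_C^{q^m-1} is 1 if m = i and 0 otherwise
(`coeff_frobSeries_pow_q_pow_sub_one`), so dividing by e_C and reading that coefficient returns c_i.
Hence the quotient of Bernoulli–Carlitz numbers is L_i times the layer i_1 = i of the polylogarithm
(`multiBC_div_BC`).

Second, H_{s-1} at t = θ with its coefficients raised to the power q^d equals Γ_s L_d^s S_d(s)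
(`twistEval_atPoly`). Indeed the roots of E_d - 1, for the Carlitz polynomial E_d, are the monics of
degree d, and E_d' = 1/L_d, so its logarithmic derivative generates the power sums; E_d(L_d x) is
the specialised Anderson–Thakur series. Summing over j with weight θ^{|j|} performs this evaluation
in every factor. Leading ones cost only factors S_d(1) = 1/L_d. -/

noncomputable section

namespace Carlitz

/-! ### Carlitz's D_i, L_i and factorials -/

section Arithmetic

variable (F : Type*) [Field F] [Fintype F]

/-- The `n`-th power `x ↦ x ^ (q ^ n)` of the Frobenius endomorphism of an `F`-algebra. -/
def frobPow (R : Type*) [CommRing R] [Algebra F R] (n : ℕ) : R →ₐ[F] R :=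
  FiniteField.frobeniusAlgHom F R ^ n

theorem frobPow_apply {R : Type*} [CommRing R] [Algebra F R] (n : ℕ) (x : R) :
    frobPow F R n x = x ^ Fintype.card F ^ n := by
  simp [frobPow, AlgHom.coe_pow, FiniteField.coe_frobeniusAlgHom, pow_iterate]

theorem one_lt_q : 1 < Fintype.card F := Fintype.one_lt_card

theorem q_pos : 0 < Fintype.card F := Fintype.card_pos

theorem sub_pow_q_pow {R : Type*} [CommRing R] [Algebra F R] (n : ℕ) (x y : R) :
    (x - y) ^ Fintype.card F ^ n = x ^ Fintype.card F ^ n - y ^ Fintype.card F ^ n := by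
  simpa only [frobPow_apply] using map_sub (frobPow F R n) x y

theorem sum_pow_q_pow {R ι : Type*} [CommRing R] [Algebra F R] (n : ℕ) (s : Finset ι) (f : ι → R) :
    (∑ i ∈ s, f i) ^ Fintype.card F ^ n = ∑ i ∈ s, f i ^ Fintype.card F ^ n := by
  simpa only [frobPow_apply] using map_sum (frobPow F R n) f s

theorem sub_pow_q {R : Type*} [CommRing R] [Algebra F R] (x y : R) :
    (x - y) ^ Fintype.card F = x ^ Fintype.card F - y ^ Fintype.card F := by
  simpa using sub_pow_q_pow F 1 x y

theorem sum_pow_q {R ι : Type*} [CommRing R] [Algebra F R] (s : Finset ι) (f : ι → R) :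
    (∑ i ∈ s, f i) ^ Fintype.card F = ∑ i ∈ s, f i ^ Fintype.card F := by
  simpa using sum_pow_q_pow F 1 s f

theorem X_pow_q_pow_ne {i j : ℕ} (h : i ≠ j) :
    (Polynomial.X : F[X]) ^ Fintype.card F ^ i - Polynomial.X ^ Fintype.card F ^ j ≠ 0 := by
  rw [sub_ne_zero]
  intro e
  have := congrArg Polynomial.natDegree e
  simp only [Polynomial.natDegree_X_pow] at this
  exact h (Nat.pow_right_injective (one_lt_q F) this)

theorem D_ne_zero (i : ℕ) : D F i ≠ 0 := by
  rw [D, Finset.prod_ne_zero_iff]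
  intro j hj
  exact X_pow_q_pow_ne F (Finset.mem_range.1 hj).ne'

theorem L_ne_zero (i : ℕ) : L F i ≠ 0 := by
  rw [L, Finset.prod_ne_zero_iff]
  intro j hj
  have := X_pow_q_pow_ne F (i := 0) (j := j) (by have := (Finset.mem_Icc.1 hj).1; omega)
  simpa using this

theorem factorial_ne_zero (n : ℕ) : factorial F n ≠ 0 := by
  rw [factorial, Finset.prod_ne_zero_iff]
  intro j _
  exact pow_ne_zero _ (D_ne_zero F j)

@[simp] theorem D_zero : D F 0 = 1 := by simp [D]

@[simp] theorem L_zero : L F 0 = 1 := by simp [L]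

theorem D_succ (i : ℕ) :
    D F (i + 1) =
      (Polynomial.X ^ Fintype.card F ^ (i + 1) - Polynomial.X) * D F i ^ Fintype.card F := by
  rw [D, Finset.prod_range_succ', mul_comm, D, ← Finset.prod_pow]
  congr 1
  · simp
  · refine Finset.prod_congr rfl fun j _ => ?_
    rw [sub_pow_q F, ← pow_mul, ← pow_mul, pow_succ, pow_succ]

theorem L_succ (i : ℕ) :
    L F (i + 1) = L F i * (Polynomial.X - Polynomial.X ^ Fintype.card F ^ (i + 1)) := by
  rw [L, Finset.prod_Icc_succ_top (by omega), L]

/-- The image of `D_i` in `k`. -/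
def DK (i : ℕ) : RatFunc F := algebraMap F[X] (RatFunc F) (D F i)

/-- The image of `L_i` in `k`. -/
def LK (i : ℕ) : RatFunc F := algebraMap F[X] (RatFunc F) (L F i)

theorem DK_ne_zero (i : ℕ) : DK F i ≠ 0 := by simpa [DK] using D_ne_zero F i

theorem LK_ne_zero (i : ℕ) : LK F i ≠ 0 := by simpa [LK] using L_ne_zero F i

@[simp] theorem DK_zero : DK F 0 = 1 := by simp [DK]

@[simp] theorem LK_zero : LK F 0 = 1 := by simp [LK]

theorem DK_succ (i : ℕ) :
    DK F (i + 1) =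
      ((RatFunc.X : RatFunc F) ^ Fintype.card F ^ (i + 1) - RatFunc.X) *
        DK F i ^ Fintype.card F := by
  simp [DK, D_succ]

theorem LK_succ (i : ℕ) :
    LK F (i + 1) =
      LK F i * ((RatFunc.X : RatFunc F) - RatFunc.X ^ Fintype.card F ^ (i + 1)) := by
  simp [LK, L_succ]

theorem X_pow_sub_ne_zero (i : ℕ) :
    (RatFunc.X : RatFunc F) ^ Fintype.card F ^ (i + 1) - RatFunc.X ≠ 0 := by
  have := DK_ne_zero F (i + 1)
  rw [DK_succ] at this
  exact left_ne_zero_of_mul this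

theorem sub_mul_inv_DK_succ (i : ℕ) :
    ((RatFunc.X : RatFunc F) ^ Fintype.card F ^ (i + 1) - RatFunc.X) * (DK F (i + 1))⁻¹ =
      (DK F i)⁻¹ ^ Fintype.card F := by
  rw [DK_succ, mul_inv, mul_inv_cancel_left₀ (X_pow_sub_ne_zero F i), inv_pow]

theorem sub_mul_inv_LK_succ (i : ℕ) :
    ((RatFunc.X : RatFunc F) ^ Fintype.card F ^ (i + 1) - RatFunc.X) * (LK F (i + 1))⁻¹ =
      -(LK F i)⁻¹ := by
  rw [LK_succ, mul_inv]
  have := X_pow_sub_ne_zero F i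
  have h2 : (RatFunc.X : RatFunc F) - RatFunc.X ^ Fintype.card F ^ (i + 1) ≠ 0 := by
    rw [← neg_sub]; exact neg_ne_zero.2 this
  field_simp
  ring

/-- The Carlitz logarithm is a left inverse of the Carlitz exponential. -/
theorem sum_inv_LK_mul_inv_DK_pow (n : ℕ) :
    ∑ m ∈ Finset.range (n + 1), (LK F m)⁻¹ * (DK F (n - m))⁻¹ ^ Fintype.card F ^ m =
      if n = 0 then 1 else 0 := by
  rcases n with _ | n
  · simp
  rw [if_neg (Nat.succ_ne_zero n)]
  -- Multiply by θ^{q^{n+1}} - θ = (θ^{q^{n+1}} - θ^{q^m}) + (θ^{q^m} - θ). The first part lowers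
  -- the index of D, the second that of L, and the two resulting sums cancel after a shift of m.
  apply (mul_eq_zero_iff_left (X_pow_sub_ne_zero F n)).1
  rw [Finset.mul_sum]
  have key : ∀ m ∈ Finset.range (n + 2),
      ((RatFunc.X : RatFunc F) ^ Fintype.card F ^ (n + 1) - RatFunc.X) *
        ((LK F m)⁻¹ * (DK F (n + 1 - m))⁻¹ ^ Fintype.card F ^ m) =
      (if m = n + 1 then 0 else (LK F m)⁻¹ * (DK F (n - m))⁻¹ ^ Fintype.card F ^ (m + 1)) -
      (if m = 0 then 0 else
        (LK F (m - 1))⁻¹ * (DK F (n + 1 - m))⁻¹ ^ Fintype.card F ^ m) := by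
    intro m hm
    have hm : m ≤ n + 1 := Nat.lt_succ_iff.1 (Finset.mem_range.1 hm)
    have e1 : ((RatFunc.X : RatFunc F) ^ Fintype.card F ^ (n + 1) -
        RatFunc.X ^ Fintype.card F ^ m) * (DK F (n + 1 - m))⁻¹ ^ Fintype.card F ^ m =
        if m = n + 1 then 0 else (DK F (n - m))⁻¹ ^ Fintype.card F ^ (m + 1) := by
      split_ifs with h
      · simp [h]
      · obtain ⟨l, rfl⟩ : ∃ l, n = m + l := ⟨n - m, by omega⟩
        rw [show m + l + 1 - m = l + 1 by omega, show m + l - m = l by omega, pow_succ' _ m,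
          pow_mul, ← sub_mul_inv_DK_succ, mul_pow, sub_pow_q_pow, ← pow_mul, ← pow_add,
          show l + 1 + m = m + l + 1 by omega]
    have e2 : ((RatFunc.X : RatFunc F) ^ Fintype.card F ^ m - RatFunc.X) * (LK F m)⁻¹ =
        - if m = 0 then 0 else (LK F (m - 1))⁻¹ := by
      rcases m with _ | m
      · simp
      · simpa using sub_mul_inv_LK_succ F m
    calc _ = (LK F m)⁻¹ * (((RatFunc.X : RatFunc F) ^ Fintype.card F ^ (n + 1) -
        RatFunc.X ^ Fintype.card F ^ m) * (DK F (n + 1 - m))⁻¹ ^ Fintype.card F ^ m) +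
        (((RatFunc.X : RatFunc F) ^ Fintype.card F ^ m - RatFunc.X) * (LK F m)⁻¹) *
        (DK F (n + 1 - m))⁻¹ ^ Fintype.card F ^ m := by ring
      _ = _ := by
        rw [e1, e2]
        split_ifs <;> ring
  rw [Finset.sum_congr rfl key, Finset.sum_sub_distrib, Finset.sum_range_succ _ (n + 1),
    Finset.sum_range_succ' _ (n + 1), if_pos rfl, if_pos rfl, sub_eq_zero]
  congr 1
  refine Finset.sum_congr rfl fun m hm => ?_
  have := Finset.mem_range.1 hm
  rw [if_neg (by omega), if_neg (by omega), Nat.add_sub_cancel, Nat.add_sub_add_right]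

/-- The Carlitz exponential is a left inverse of the Carlitz logarithm. -/
theorem sum_inv_DK_mul_inv_LK_pow (n : ℕ) :
    ∑ i ∈ Finset.range (n + 1), (DK F i)⁻¹ * (LK F (n - i))⁻¹ ^ Fintype.card F ^ i =
      if n = 0 then 1 else 0 := by
  induction n with
  | zero => simp
  | succ n ih =>
  rw [if_neg (Nat.succ_ne_zero n)]
  -- With the same splitting, the sum becomes Σ^q - Σ, where Σ is the sum for n. By induction Σ is 0
  -- or 1, hence fixed by Frobenius.
  apply (mul_eq_zero_iff_left (X_pow_sub_ne_zero F n)).1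
  rw [Finset.mul_sum]
  have key : ∀ i ∈ Finset.range (n + 2),
      ((RatFunc.X : RatFunc F) ^ Fintype.card F ^ (n + 1) - RatFunc.X) *
        ((DK F i)⁻¹ * (LK F (n + 1 - i))⁻¹ ^ Fintype.card F ^ i) =
      (if i = 0 then 0 else
        ((DK F (i - 1))⁻¹ * (LK F (n + 1 - i))⁻¹ ^ Fintype.card F ^ (i - 1)) ^ Fintype.card F) -
      (if i = n + 1 then 0 else (DK F i)⁻¹ * (LK F (n - i))⁻¹ ^ Fintype.card F ^ i) := by
    intro i hi
    have hi : i ≤ n + 1 := Nat.lt_succ_iff.1 (Finset.mem_range.1 hi)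
    have e1 : ((RatFunc.X : RatFunc F) ^ Fintype.card F ^ (n + 1) -
        RatFunc.X ^ Fintype.card F ^ i) * (LK F (n + 1 - i))⁻¹ ^ Fintype.card F ^ i =
        if i = n + 1 then 0 else -(LK F (n - i))⁻¹ ^ Fintype.card F ^ i := by
      split_ifs with h
      · simp [h]
      · obtain ⟨l, rfl⟩ : ∃ l, n = i + l := ⟨n - i, by omega⟩
        have h := congrArg (frobPow F _ i) (sub_mul_inv_LK_succ F l)
        rw [map_mul, map_sub, map_neg] at h
        simp only [frobPow_apply] at h
        rw [show i + l + 1 - i = l + 1 by omega, show i + l - i = l by omega, ← h, ← pow_mul,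
          ← pow_add, show l + 1 + i = i + l + 1 by omega]
    have e2 : ((RatFunc.X : RatFunc F) ^ Fintype.card F ^ i - RatFunc.X) * (DK F i)⁻¹ =
        if i = 0 then 0 else (DK F (i - 1))⁻¹ ^ Fintype.card F := by
      rcases i with _ | i
      · simp
      · simpa using sub_mul_inv_DK_succ F i
    have e3 : i ≠ 0 → (LK F (n + 1 - i))⁻¹ ^ Fintype.card F ^ i =
        ((LK F (n + 1 - i))⁻¹ ^ Fintype.card F ^ (i - 1)) ^ Fintype.card F := by
      intro h
      rw [← pow_mul, ← pow_succ, Nat.sub_add_cancel (Nat.pos_of_ne_zero h)]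
    calc _ = (DK F i)⁻¹ * (((RatFunc.X : RatFunc F) ^ Fintype.card F ^ (n + 1) -
        RatFunc.X ^ Fintype.card F ^ i) * (LK F (n + 1 - i))⁻¹ ^ Fintype.card F ^ i) +
        (((RatFunc.X : RatFunc F) ^ Fintype.card F ^ i - RatFunc.X) * (DK F i)⁻¹) *
        (LK F (n + 1 - i))⁻¹ ^ Fintype.card F ^ i := by ring
      _ = _ := by
        rw [e1, e2, mul_pow]
        rcases eq_or_ne i 0 with h0 | h0
        · simp only [h0]; split_ifs <;> simp
        · rw [← e3 h0, if_neg h0, if_neg h0]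
          split_ifs <;> ring
  rw [Finset.sum_congr rfl key, Finset.sum_sub_distrib, Finset.sum_range_succ' _ (n + 1),
    Finset.sum_range_succ _ (n + 1), if_pos rfl, if_pos rfl, add_zero, add_zero, sub_eq_zero]
  have h1 := congrArg (· ^ Fintype.card F) ih
  simp only [sum_pow_q] at h1
  have h2 : ∀ b : Prop, [Decidable b] → (if b then (1 : RatFunc F) else 0) ^ Fintype.card F =
      if b then 1 else 0 := by
    intro b _; split_ifs <;> simp [(q_pos F).ne']
  rw [h2, ← ih] at h1
  convert h1 using 1
  · refine Finset.sum_congr rfl fun i hi => ?_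
    rw [if_neg (Nat.succ_ne_zero i), Nat.add_sub_cancel, Nat.add_sub_add_right]
  · refine Finset.sum_congr rfl fun i hi => ?_
    have := Finset.mem_range.1 hi
    rw [if_neg (by omega)]

/-! ### Divisibility of Carlitz factorials -/

theorem factorial_eq_prod_range {n N : ℕ} (h : n < N) :
    factorial F n =
      ∏ i ∈ Finset.range N, D F i ^ (n / Fintype.card F ^ i % Fintype.card F) := by
  rw [factorial]
  refine Finset.prod_subset (Finset.range_subset_range.2 h) fun i _ hi => ?_
  have : n < Fintype.card F ^ i :=
    (by simpa using hi : n < i).trans (Nat.lt_pow_self (one_lt_q F))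
  rw [Nat.div_eq_of_lt this, Nat.zero_mod, pow_zero]

/-- Without a carry, adding q^i changes the i-th digit only. -/
theorem factorial_add_pow {n i : ℕ}
    (h : n / Fintype.card F ^ i % Fintype.card F + 1 < Fintype.card F) :
    factorial F (n + Fintype.card F ^ i) = D F i * factorial F n := by
  have hq := q_pos F
  set q := Fintype.card F with hqdef
  have hi : i < n + q ^ i + 1 := by
    have : i < q ^ i := Nat.lt_pow_self (one_lt_q F)
    omega
  rw [factorial_eq_prod_range F (Nat.lt_succ_self (n + q ^ i)),
    factorial_eq_prod_range F (show n < n + q ^ i + 1 by omega),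
    ← Finset.mul_prod_erase _ _ (Finset.mem_range.2 hi),
    ← Finset.mul_prod_erase _ _ (Finset.mem_range.2 hi), ← mul_assoc, ← pow_succ']
  simp only [← hqdef]
  have hdiv : (n + q ^ i) / q ^ i = n / q ^ i + 1 := Nat.add_div_right _ (pow_pos hq i)
  congr 1
  · rw [hdiv, Nat.add_mod, Nat.mod_eq_of_lt (one_lt_q F), Nat.mod_eq_of_lt h]
  · refine Finset.prod_congr rfl fun j hj => ?_
    congr 1
    have hj : j ≠ i := (Finset.mem_erase.1 hj).1
    rcases lt_or_gt_of_ne hj with hj | hj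
    · obtain ⟨l, rfl⟩ : ∃ l, i = j + 1 + l := ⟨i - (j + 1), by omega⟩
      rw [show q ^ (j + 1 + l) = q * q ^ l * q ^ j by ring,
        Nat.add_mul_div_right _ _ (pow_pos hq j), Nat.add_mul_mod_self_left]
    · obtain ⟨l, rfl⟩ : ∃ l, j = i + 1 + l := ⟨j - (i + 1), by omega⟩
      have e : ∀ m, m / q ^ (i + 1 + l) = m / q ^ i / q / q ^ l := by
        intro m; rw [Nat.div_div_eq_div_mul, Nat.div_div_eq_div_mul, pow_add, pow_succ, mul_assoc]
      rw [e, e, hdiv]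
      congr 2
      have h3 := Nat.div_add_mod (n / q ^ i) q
      rw [← h3, add_assoc, Nat.mul_add_div hq, Nat.mul_add_div hq, Nat.div_eq_of_lt h,
        Nat.div_eq_of_lt (Nat.mod_lt _ hq)]

theorem factorial_add_mul_pow {n i : ℕ} (h : n / Fintype.card F ^ i % Fintype.card F = 0)
    {c : ℕ} (hc : c < Fintype.card F) :
    factorial F (n + c * Fintype.card F ^ i) = D F i ^ c * factorial F n := by
  have hq := q_pos F
  induction c with
  | zero => simp
  | succ c ih =>
    rw [add_mul, one_mul, ← add_assoc, factorial_add_pow, ih (by omega), pow_succ']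
    · ring
    · rw [Nat.add_mul_div_right _ _ (pow_pos hq i), Nat.add_mod, h, zero_add, Nat.mod_mod,
        Nat.mod_eq_of_lt (by omega)]
      exact hc

/-- This keeps the recursion for the Anderson–Thakur polynomials inside A[t]. Without a carry there
is equality. With a carry the i-th digit is q - 1; clearing it leaves m with n + q^i = m + q^{i+1},
and D_i^q divides D_{i+1}, so induction applies to m at position i + 1. -/
theorem D_mul_factorial_dvd (n i : ℕ) :
    D F i * factorial F n ∣ factorial F (n + Fintype.card F ^ i) := by
  have hq1 := one_lt_q F
  have hq := q_pos F
  induction n using Nat.strong_induction_on generalizing i with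
  | _ n ih =>
  by_cases h : n / Fintype.card F ^ i % Fintype.card F + 1 < Fintype.card F
  · rw [factorial_add_pow F h]
  · have h1 : n / Fintype.card F ^ i % Fintype.card F = Fintype.card F - 1 := by
      have := Nat.mod_lt (n / Fintype.card F ^ i) hq
      omega
    set q := Fintype.card F with hqdef
    have hle : (q - 1) * q ^ i ≤ n := by
      have h2 : q - 1 ≤ n / q ^ i := h1 ▸ Nat.mod_le _ _
      calc _ ≤ n / q ^ i * q ^ i := Nat.mul_le_mul_right _ h2
        _ ≤ n := Nat.div_mul_le_self _ _
    obtain ⟨m, rfl⟩ : ∃ m, n = m + (q - 1) * q ^ i := ⟨n - (q - 1) * q ^ i, by omega⟩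
    have h0 : m / q ^ i % q = 0 := by
      rw [Nat.add_mul_div_right _ _ (pow_pos hq i)] at h1
      have h3 : (m / q ^ i + (q - 1)) % q = (0 + (q - 1)) % q := by
        rw [h1, zero_add, Nat.mod_eq_of_lt (by omega)]
      have h4 : m / q ^ i ≡ 0 [MOD q] := Nat.ModEq.add_right_cancel' (q - 1) h3
      simpa [Nat.ModEq] using h4
    have e1 : m + (q - 1) * q ^ i + q ^ i = m + q ^ (i + 1) := by
      obtain ⟨c, hc⟩ : ∃ c, q = c + 1 := ⟨q - 1, by omega⟩
      rw [show q - 1 = c by omega, pow_succ]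
      nth_rw 4 [hc]
      ring
    have e2 : D F i * factorial F (m + (q - 1) * q ^ i) = D F i ^ q * factorial F m := by
      rw [factorial_add_mul_pow F h0 (by omega), ← mul_assoc, ← pow_succ',
        Nat.sub_add_cancel (by omega)]
    rw [e1, e2]
    refine dvd_trans ?_ (ih m ?_ (i + 1))
    · rw [D_succ]
      exact mul_dvd_mul_right (dvd_mul_left _ _) _
    · have : 0 < (q - 1) * q ^ i := Nat.mul_pos (by omega) (pow_pos hq i)
      omega

end Arithmetic

/-! ### Linear power series and their composition -/

section Linear

variable (F : Type*) [Field F] [Fintype F] {K : Type*} [Field K]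

theorem coeff_frobSeries_q_pow (c : ℕ → K) (i : ℕ) :
    PowerSeries.coeff (Fintype.card F ^ i) (frobSeries F c) = c i := by
  rw [frobSeries, PowerSeries.coeff_mk, Finset.sum_eq_single_of_mem i]
  · simp
  · exact Finset.mem_range.2 (Nat.lt_succ_of_lt (Nat.lt_pow_self (one_lt_q F)))
  · intro j _ hj
    exact if_neg fun e => hj (Nat.pow_right_injective (one_lt_q F) e).symm

omit [Field F] in
theorem coeff_frobSeries_of_ne (c : ℕ → K) {n : ℕ} (h : ∀ i, n ≠ Fintype.card F ^ i) :
    PowerSeries.coeff n (frobSeries F c) = 0 := by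
  rw [frobSeries, PowerSeries.coeff_mk]
  exact Finset.sum_eq_zero fun i _ => if_neg (h i)

theorem constantCoeff_frobSeries (c : ℕ → K) :
    PowerSeries.constantCoeff (frobSeries F c) = 0 := by
  rw [← PowerSeries.coeff_zero_eq_constantCoeff_apply]
  exact coeff_frobSeries_of_ne F c fun i => (pow_pos (q_pos F) i).ne

theorem coeff_pow_eq_zero_of_lt {f : K⟦X⟧} (hf : PowerSeries.constantCoeff f = 0) {n m : ℕ}
    (h : n < m) : PowerSeries.coeff n (f ^ m) = 0 := by
  have h1 : (PowerSeries.X : K⟦X⟧) ∣ f := PowerSeries.X_dvd_iff.2 hf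
  exact PowerSeries.X_pow_dvd_iff.1 (pow_dvd_pow_of_dvd h1 m) n h

theorem le_q_pow_sub_one (m : ℕ) : m ≤ Fintype.card F ^ m - 1 :=
  Nat.le_sub_one_of_lt (Nat.lt_pow_self (one_lt_q F))

/-- The q^n-th power is additive, and truncating g beyond degree m does not affect the coefficient,
so it suffices to raise finitely many monomials to that power. -/
theorem coeff_pow_q_pow [Algebra F K] (g : K⟦X⟧) (n m : ℕ) :
    PowerSeries.coeff m (g ^ Fintype.card F ^ n) =
      if Fintype.card F ^ n ∣ m then
        PowerSeries.coeff (m / Fintype.card F ^ n) g ^ Fintype.card F ^ n else 0 := by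
  have hq : 0 < Fintype.card F ^ n := pow_pos (q_pos F) n
  have h1 : PowerSeries.X ^ (m + 1) ∣ g - ((PowerSeries.trunc (m + 1) g : K[X]) : K⟦X⟧) := by
    rw [PowerSeries.X_pow_dvd_iff]
    intro i hi
    rw [map_sub, Polynomial.coeff_coe, PowerSeries.coeff_trunc, if_pos hi, sub_self]
  have h2 := pow_dvd_pow_of_dvd h1 (Fintype.card F ^ n)
  rw [sub_pow_q_pow, ← pow_mul, PowerSeries.X_pow_dvd_iff] at h2
  have h3 := h2 m (by
    calc m < (m + 1) * 1 := by omega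
      _ ≤ _ := Nat.mul_le_mul_left _ hq)
  rw [map_sub, sub_eq_zero] at h3
  have h4 : ((PowerSeries.trunc (m + 1) g : K[X]) : K⟦X⟧) =
      ∑ i ∈ Finset.range (m + 1), PowerSeries.monomial i (PowerSeries.coeff i g) := by
    ext k
    simp only [Polynomial.coeff_coe, PowerSeries.coeff_trunc, map_sum,
      PowerSeries.coeff_monomial, Finset.sum_ite_eq, Finset.mem_range]
  rw [h3, h4, sum_pow_q_pow, map_sum]
  simp only [PowerSeries.monomial_pow, PowerSeries.coeff_monomial]
  split_ifs with hd
  · obtain ⟨l, rfl⟩ := hd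
    rw [Nat.mul_div_cancel_left _ hq, Finset.sum_eq_single_of_mem l]
    · rw [if_pos (by simp)]
    · exact Finset.mem_range.2 (Nat.lt_succ_of_le (Nat.le_mul_of_pos_left _ hq))
    · intro j _ hj
      refine if_neg fun e => hj ?_
      exact (Nat.eq_of_mul_eq_mul_left hq e).symm
  · refine Finset.sum_eq_zero fun i _ => if_neg fun e => hd ?_
    rw [e]
    exact dvd_mul_right _ _

theorem frobSeries_pow [Algebra F K] (c : ℕ → K) (m : ℕ) :
    frobSeries F c ^ Fintype.card F ^ m =
      frobSeries F fun i => if i < m then 0 else c (i - m) ^ Fintype.card F ^ m := by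
  have hq : 0 < Fintype.card F ^ m := pow_pos (q_pos F) m
  ext n
  rw [coeff_pow_q_pow]
  by_cases h : ∃ i, n = Fintype.card F ^ i
  · obtain ⟨i, rfl⟩ := h
    have hd := Nat.pow_dvd_pow_iff_le_right (k := m) (l := i) (one_lt_q F)
    rw [coeff_frobSeries_q_pow]
    by_cases him : i < m
    · rw [if_neg (by omega), if_pos him]
    · rw [if_pos (by omega), if_neg him, Nat.pow_div (by omega) (q_pos F), coeff_frobSeries_q_pow]
  · push Not at h
    rw [coeff_frobSeries_of_ne F _ h]
    split_ifs with hd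
    · obtain ⟨l, rfl⟩ := hd
      rw [Nat.mul_div_cancel_left _ hq, coeff_frobSeries_of_ne, zero_pow hq.ne']
      intro i hi
      exact h (m + i) (by rw [hi, pow_add])
    · rfl

/-- The linear series is X plus a series in X^q, and g^q is a series in X^q. In the binomial
expansion only X^{q-1} reaches exponents congruent to -1 modulo q. -/
theorem coeff_frobSeries_pow_mul_pow [Algebra F K] {c : ℕ → K} (hc : c 0 = 1) (g : K⟦X⟧) (n : ℕ) :
    PowerSeries.coeff (Fintype.card F - 1 + Fintype.card F * n)
      (frobSeries F c ^ (Fintype.card F - 1) * g ^ Fintype.card F) =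
      PowerSeries.coeff n g ^ Fintype.card F := by
  have hq := q_pos F
  have hq0 := hq.ne'
  have h1 : frobSeries F c = PowerSeries.X +
      PowerSeries.expand (Fintype.card F) hq0 (frobSeries F fun i => c (i + 1)) := by
    ext m
    rw [map_add, PowerSeries.coeff_X, PowerSeries.coeff_expand]
    by_cases h : ∃ i, m = Fintype.card F ^ i
    · obtain ⟨i, rfl⟩ := h
      rw [coeff_frobSeries_q_pow]
      rcases i with _ | i
      · rw [pow_zero, if_pos rfl, if_neg, hc, add_zero]
        exact fun h => (one_lt_q F).ne' (Nat.dvd_one.1 h)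
      · rw [if_neg (Nat.one_lt_pow (Nat.succ_ne_zero i) (one_lt_q F)).ne', if_pos
          (dvd_pow_self _ (Nat.succ_ne_zero i)), pow_succ, Nat.mul_div_cancel _ hq,
          coeff_frobSeries_q_pow, zero_add]
    · push Not at h
      rw [coeff_frobSeries_of_ne F _ h, if_neg (by simpa using h 0), zero_add]
      split_ifs with hd
      · obtain ⟨l, rfl⟩ := hd
        rw [Nat.mul_div_cancel_left _ hq, coeff_frobSeries_of_ne]
        intro i hi
        exact h (i + 1) (by rw [hi, pow_succ'])
      · rfl
  have h2 : g ^ Fintype.card F = PowerSeries.expand (Fintype.card F) hq0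
      (PowerSeries.mk fun i => PowerSeries.coeff i g ^ Fintype.card F) := by
    ext m
    rw [PowerSeries.coeff_expand]
    simpa using coeff_pow_q_pow F g 1 m
  rw [h1, h2, add_pow, Finset.sum_mul, map_sum, Finset.sum_eq_single_of_mem (Fintype.card F - 1)]
  · rw [Nat.sub_self, pow_zero, mul_one, Nat.choose_self, Nat.cast_one, mul_one,
      add_comm (Fintype.card F - 1), PowerSeries.coeff_X_pow_mul, PowerSeries.coeff_expand,
      if_pos (dvd_mul_right _ _), Nat.mul_div_cancel_left _ hq, PowerSeries.coeff_mk]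
  · exact Finset.mem_range.2 (Nat.lt_succ_self _)
  · intro a ha hne
    have ha : a < Fintype.card F - 1 := by
      have := Finset.mem_range.1 ha
      omega
    rw [mul_assoc, mul_assoc, PowerSeries.coeff_X_pow_mul', if_pos (by omega), ← map_natCast
      (PowerSeries.expand (Fintype.card F) hq0), ← map_pow, ← map_mul, ← map_mul,
      PowerSeries.coeff_expand_of_not_dvd]
    intro hd
    rw [show Fintype.card F - 1 + Fintype.card F * n - a =
      (Fintype.card F - 1 - a) + Fintype.card F * n by omega,
      ← Nat.dvd_add_iff_left (dvd_mul_right _ _)] at hd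
    have := Nat.le_of_dvd (by omega) hd
    omega

/-- Since q^{l+1} - 1 = (q - 1) + q(q^l - 1), the previous lemma lowers m and i together. -/
theorem coeff_frobSeries_pow_q_pow_sub_one [Algebra F K] {c : ℕ → K} (hc : c 0 = 1) (i m : ℕ) :
    PowerSeries.coeff (Fintype.card F ^ i - 1) (frobSeries F c ^ (Fintype.card F ^ m - 1)) =
      if m = i then 1 else 0 := by
  have hq := q_pos F
  induction m generalizing i with
  | zero =>
    rw [pow_zero, Nat.sub_self, pow_zero, PowerSeries.coeff_one]
    rcases i with _ | i
    · simp
    · have := Nat.one_lt_pow (Nat.succ_ne_zero i) (one_lt_q F)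
      simp only [Nat.succ_eq_add_one] at *
      rw [if_neg (by omega), if_neg (by omega)]
  | succ m ih =>
    rcases i with _ | i
    · rw [pow_zero, Nat.sub_self, if_neg (by omega)]
      refine coeff_pow_eq_zero_of_lt (constantCoeff_frobSeries F c) ?_
      have := le_q_pow_sub_one F (m + 1)
      omega
    · have e : ∀ l, Fintype.card F ^ (l + 1) - 1 =
          Fintype.card F - 1 + Fintype.card F * (Fintype.card F ^ l - 1) := by
        intro l
        have h1 : 0 < Fintype.card F ^ l := pow_pos hq l
        have h2 := Nat.le_mul_of_pos_right (Fintype.card F) h1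
        rw [Nat.mul_sub, mul_one, pow_succ']
        omega
      rw [e, e, pow_add, mul_comm (Fintype.card F) (Fintype.card F ^ m - 1), pow_mul,
        coeff_frobSeries_pow_mul_pow F hc, ih]
      simp only [Nat.add_right_cancel_iff]
      split_ifs <;> simp [hq.ne']

/-- The power series `∑_m c_m f ^ (q ^ m)`, for `f` without constant term. -/
def compLin (c : ℕ → K) (f : K⟦X⟧) : K⟦X⟧ :=
  PowerSeries.mk fun n =>
    ∑ m ∈ Finset.range (n + 1), c m * PowerSeries.coeff n (f ^ Fintype.card F ^ m)

/-- Termwise f^{q^m} = f · f^{q^m-1}; this turns the Laurent quotient by f into a power series with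
known coefficients. -/
theorem mul_mk_eq_compLin (c : ℕ → K) {f : K⟦X⟧} (hf : PowerSeries.constantCoeff f = 0) :
    f * (PowerSeries.mk fun n => ∑ m ∈ Finset.range (n + 1),
      c m * PowerSeries.coeff n (f ^ (Fintype.card F ^ m - 1))) = compLin F c f := by
  ext n
  rw [compLin, PowerSeries.coeff_mk, PowerSeries.coeff_mul]
  have h1 : ∀ x ∈ Finset.HasAntidiagonal.antidiagonal n, PowerSeries.coeff x.1 f *
      PowerSeries.coeff x.2 (PowerSeries.mk fun n => ∑ m ∈ Finset.range (n + 1),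
        c m * PowerSeries.coeff n (f ^ (Fintype.card F ^ m - 1))) =
      ∑ m ∈ Finset.range (n + 1), c m * (PowerSeries.coeff x.1 f *
        PowerSeries.coeff x.2 (f ^ (Fintype.card F ^ m - 1))) := by
    intro x hx
    have hx2 : x.2 ≤ n := Finset.HasAntidiagonal.antidiagonal.snd_le hx
    rw [PowerSeries.coeff_mk, Finset.sum_subset (Finset.range_subset_range.2
      (Nat.succ_le_succ hx2)), Finset.mul_sum]
    · exact Finset.sum_congr rfl fun m _ => by ring
    · intro m _ hm
      rw [coeff_pow_eq_zero_of_lt hf, mul_zero]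
      have := le_q_pow_sub_one F m
      have := Finset.mem_range.not.1 hm
      omega
  rw [Finset.sum_congr rfl h1, Finset.sum_comm]
  refine Finset.sum_congr rfl fun m _ => ?_
  rw [← Finset.mul_sum, ← PowerSeries.coeff_mul, ← pow_succ',
    Nat.sub_add_cancel (pow_pos (q_pos F) m)]

theorem frobSeries_ne_zero {c : ℕ → K} (hc : c 0 = 1) : frobSeries F c ≠ 0 := by
  intro h
  have := coeff_frobSeries_q_pow F c 0
  rw [h, hc, map_zero] at this
  exact zero_ne_one this

theorem coeff_compLin_div [Algebra F K] (a : ℕ → K) {c : ℕ → K} (hc : c 0 = 1) (i : ℕ) :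
    HahnSeries.coeff (((compLin F a (frobSeries F c) : K⟦X⟧) : K⸨X⸩) /
      ((frobSeries F c : K⟦X⟧) : K⸨X⸩)) ((Fintype.card F ^ i - 1 : ℕ) : ℤ) = a i := by
  have h0 : ((frobSeries F c : K⟦X⟧) : K⸨X⸩) ≠ 0 := by
    rw [Ne, ← PowerSeries.coe_zero, (HahnSeries.ofPowerSeries_injective).eq_iff]
    exact frobSeries_ne_zero F hc
  rw [← mul_mk_eq_compLin F a (constantCoeff_frobSeries F c), PowerSeries.coe_mul,
    mul_div_cancel_left₀ _ h0, LaurentSeries.coeff_coe_powerSeries, PowerSeries.coeff_mk,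
    Finset.sum_eq_single_of_mem i]
  · rw [coeff_frobSeries_pow_q_pow_sub_one F hc, if_pos rfl, mul_one]
  · exact Finset.mem_range.2 (Nat.lt_succ_of_le (le_q_pow_sub_one F i))
  · intro m _ hm
    rw [coeff_frobSeries_pow_q_pow_sub_one F hc, if_neg hm, mul_zero]

theorem expC_eq : expC F = frobSeries F fun i => (DK F i)⁻¹ := rfl

/-- `log_C (e_C z) = z`. -/
theorem compLin_inv_LK : compLin F (fun m => (LK F m)⁻¹) (expC F) = PowerSeries.X := by
  ext n
  rw [compLin, PowerSeries.coeff_mk, PowerSeries.coeff_X, expC_eq]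
  simp only [frobSeries_pow]
  by_cases h : ∃ N, n = Fintype.card F ^ N
  · obtain ⟨N, rfl⟩ := h
    have hN := Nat.lt_pow_self (n := N) (one_lt_q F)
    simp only [coeff_frobSeries_q_pow]
    rw [← Finset.sum_subset (Finset.range_subset_range.2 (Nat.succ_le_succ hN.le))]
    · have h1 : (if Fintype.card F ^ N = 1 then (1 : RatFunc F) else 0) = if N = 0 then 1 else 0 :=
        if_congr (Nat.pow_eq_one.trans (or_iff_right (one_lt_q F).ne')) rfl rfl
      rw [h1, ← sum_inv_LK_mul_inv_DK_pow]
      refine Finset.sum_congr rfl fun m hm => ?_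
      have := Finset.mem_range.1 hm
      rw [if_neg (by omega)]
    · intro m _ hm
      have := Finset.mem_range.not.1 hm
      rw [if_pos (by omega), mul_zero]
  · push Not at h
    rw [if_neg (by simpa using h 0)]
    exact Finset.sum_eq_zero fun m _ => by rw [coeff_frobSeries_of_ne F _ h, mul_zero]

/-- Writing z as log_C(e_C(z)) makes z / e_C(z) a case of `coeff_compLin_div` with coefficients
1/L_m. -/
theorem BC_q_pow_sub_one (i : ℕ) :
    BC F (Fintype.card F ^ i - 1) =
      algebraMap F[X] (RatFunc F) (factorial F (Fintype.card F ^ i - 1)) * (LK F i)⁻¹ := by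
  rw [BC, ← compLin_inv_LK, expC_eq, coeff_compLin_div F _ (by simp)]

end Linear

/-! ### The polylogarithm as a linear series in e_C -/

section Polylog

variable {F : Type*} [Field F] [Fintype F] {r : ℕ}

theorem mem_decTuples {n a b : ℕ} {i : Fin n → ℕ} :
    i ∈ decTuples n a b ↔ (∀ l, a ≤ i l ∧ i l < b) ∧ StrictAnti i := by
  simp [decTuples, Fintype.mem_piFinset]

/-- The strictly decreasing tuples of length `r` with first entry `m`. -/
def headTuples (hr : 0 < r) (m : ℕ) : Finset (Fin r → ℕ) :=
  (decTuples r 0 (m + 1)).filter fun i => i ⟨0, hr⟩ = m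

theorem mem_headTuples {hr : 0 < r} {m : ℕ} {i : Fin r → ℕ} :
    i ∈ headTuples hr m ↔ StrictAnti i ∧ i ⟨0, hr⟩ = m := by
  rw [headTuples, Finset.mem_filter, mem_decTuples]
  constructor
  · exact fun h => ⟨h.1.2, h.2⟩
  · refine fun h => ⟨⟨fun l => ⟨Nat.zero_le _, ?_⟩, h.1⟩, h.2⟩
    have : i l ≤ i ⟨0, hr⟩ := h.1.antitone (Fin.mk_le_of_le_val (Nat.zero_le _))
    omega

/-- Only the first argument involves z, so a tuple contributes a constant times e_C^{q^{i_1}}; group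
the tuples by i_1. -/
theorem Li_eq_compLin (hr : 0 < r) (s : Fin r → ℕ) (v : Fin r → RatFunc F) :
    (Li s fun l : Fin r => (if (l : ℕ) = 0 then expC F else 1) * PowerSeries.C (v l)) =
      compLin F (fun m => ∑ i ∈ headTuples hr m,
        ∏ l, (v l ^ Fintype.card F ^ i l * (LK F (i l) ^ s l)⁻¹)) (expC F) := by
  ext n
  have h1 : ∀ i : Fin r → ℕ, PowerSeries.coeff n
      (∏ l : Fin r, (((if (l : ℕ) = 0 then expC F else 1) * PowerSeries.C (v l)) ^ Fintype.card F ^ i l *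
        PowerSeries.C (((algebraMap F[X] (RatFunc F) (L F (i l))) ^ s l)⁻¹))) =
      (∏ l, (v l ^ Fintype.card F ^ i l * (LK F (i l) ^ s l)⁻¹)) *
        PowerSeries.coeff n (expC F ^ Fintype.card F ^ i ⟨0, hr⟩) := by
    intro i
    have h2 : ∀ l : Fin r, ((if (l : ℕ) = 0 then expC F else 1) * PowerSeries.C (v l)) ^
        Fintype.card F ^ i l *
        PowerSeries.C (((algebraMap F[X] (RatFunc F) (L F (i l))) ^ s l)⁻¹) =
        (if l = ⟨0, hr⟩ then expC F ^ Fintype.card F ^ i l else 1) *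
        PowerSeries.C (v l ^ Fintype.card F ^ i l * (LK F (i l) ^ s l)⁻¹) := by
      intro l
      rw [mul_pow, map_mul, map_pow, mul_assoc, LK]
      congr 1
      simp only [Fin.ext_iff]
      split_ifs <;> simp
    rw [Finset.prod_congr rfl fun l _ => h2 l, Finset.prod_mul_distrib, Finset.prod_ite_eq',
      if_pos (Finset.mem_univ _), ← map_prod, PowerSeries.coeff_mul_C, mul_comm]
  -- The order of e_C^{q^m} is at least q^m > m, so the tuples with i_1 ≤ n suffice and the `finsum`
  -- becomes a finite sum.
  have h3 : ∀ i : Fin r → ℕ, n < i ⟨0, hr⟩ →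
      PowerSeries.coeff n (expC F ^ Fintype.card F ^ i ⟨0, hr⟩) = 0 := by
    intro i hi
    exact coeff_pow_eq_zero_of_lt (constantCoeff_frobSeries F _)
      (hi.trans (Nat.lt_pow_self (one_lt_q F)))
  rw [Li, PowerSeries.coeff_mk, compLin, PowerSeries.coeff_mk]
  simp only [h1]
  rw [finsum_subtype_eq_finsum_cond (M := RatFunc F) (f := fun i : Fin r → ℕ =>
      (∏ l, (v l ^ Fintype.card F ^ i l * (LK F (i l) ^ s l)⁻¹)) *
        PowerSeries.coeff n (expC F ^ Fintype.card F ^ i ⟨0, hr⟩)) (p := StrictAnti),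
    finsum_cond_eq_sum_of_cond_iff (t := decTuples r 0 (n + 1)),
    ← Finset.sum_fiberwise_of_maps_to (s := decTuples r 0 (n + 1)) (t := Finset.range (n + 1))
      (g := fun i => i ⟨0, hr⟩)]
  · refine Finset.sum_congr rfl fun m hm => ?_
    rw [Finset.sum_mul]
    refine Finset.sum_congr ?_ fun i hi => ?_
    · ext i
      rw [mem_headTuples, Finset.mem_filter, mem_decTuples]
      refine ⟨fun h => ⟨h.1.2, h.2⟩, fun h => ⟨⟨fun l => ⟨Nat.zero_le _, ?_⟩, h.1⟩, h.2⟩⟩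
      have : i l ≤ i ⟨0, hr⟩ := h.1.antitone (Fin.mk_le_of_le_val (Nat.zero_le _))
      have := Finset.mem_range.1 hm
      omega
    · rw [(mem_headTuples.1 hi).2]
  · intro i hi
    exact Finset.mem_range.2 ((mem_decTuples.1 hi).1 _).2
  · intro i hi
    rw [mem_decTuples]
    refine ⟨fun h => ⟨fun l => ⟨Nat.zero_le _, ?_⟩, h⟩, fun h => h.2⟩
    have h4 : i l ≤ i ⟨0, hr⟩ := h.antitone (Fin.mk_le_of_le_val (Nat.zero_le _))
    have : ¬ n < i ⟨0, hr⟩ := fun h5 => hi (by rw [h3 i h5, mul_zero])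
    omega

theorem multiBC_div_BC (hr : 0 < r) (s j : Fin r → ℕ) (m : ℕ) :
    multiBC (F := F) s j (Fintype.card F ^ m - 1) / BC F (Fintype.card F ^ m - 1) =
      LK F m * ∑ i ∈ headTuples hr m, ∏ l,
        (algebraMap F[X] (RatFunc F) (u s l (j l)) ^ Fintype.card F ^ i l *
          (LK F (i l) ^ s l)⁻¹) := by
  have h0 : algebraMap F[X] (RatFunc F) (factorial F (Fintype.card F ^ m - 1)) ≠ 0 := by
    simpa using factorial_ne_zero F _
  have h1 := LK_ne_zero F m
  rw [multiBC, Li_eq_compLin hr, BC_q_pow_sub_one, expC_eq, coeff_compLin_div F _ (by simp)]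
  field_simp

end Polylog

/-! ### Carlitz polynomials and power sums -/

section PowerSums

variable (F : Type*) [Field F] [Fintype F]

theorem finite_monic_natDegree_eq (d : ℕ) : {a : F[X] | a.Monic ∧ a.natDegree = d}.Finite :=
  Set.finite_coe_iff.1 (Finite.of_equiv (Fin d → F)
    ((Polynomial.monicEquivDegreeLT d).trans (Polynomial.degreeLTEquiv F d).toEquiv).symm)

/-- The monic polynomials of degree `d`. -/
def monics (d : ℕ) : Finset F[X] := (finite_monic_natDegree_eq F d).toFinset

variable {F} in
theorem mem_monics {d : ℕ} {a : F[X]} : a ∈ monics F d ↔ a.Monic ∧ a.natDegree = d := by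
  simp [monics]

theorem card_monics (d : ℕ) : (monics F d).card = Fintype.card F ^ d := by
  rw [monics, ← Nat.card_eq_card_finite_toFinset]
  exact (Nat.card_congr ((Polynomial.monicEquivDegreeLT d).trans
    (Polynomial.degreeLTEquiv F d).toEquiv)).trans (by simp)

/-- The power sum `S_d(s) = ∑ a⁻ˢ` over monic polynomials `a` of degree `d`. -/
def powerSum (d s : ℕ) : RatFunc F := ∑ a ∈ monics F d, (algebraMap F[X] (RatFunc F) a ^ s)⁻¹

/-- The coefficients of the Carlitz polynomial `E_d`. -/
def carlitzCoeff (d i : ℕ) : RatFunc F := (DK F i)⁻¹ * (LK F (d - i))⁻¹ ^ Fintype.card F ^ i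

/-- The Carlitz polynomial `E_d(y) = ∑_{i ≤ d} y ^ (q ^ i) / (D_i L_{d-i} ^ (q ^ i))`. -/
def carlitzE (d : ℕ) : (RatFunc F)[X] :=
  ∑ i ∈ Finset.range (d + 1),
    Polynomial.C (carlitzCoeff F d i) * Polynomial.X ^ Fintype.card F ^ i

theorem eval_carlitzE (d : ℕ) (y : RatFunc F) :
    (carlitzE F d).eval y =
      ∑ i ∈ Finset.range (d + 1), carlitzCoeff F d i * frobPow F (RatFunc F) i y := by
  simp [carlitzE, Polynomial.eval_finsetSum, frobPow_apply]

theorem eval_carlitzE_sum {ι : Type*} (d : ℕ) (s : Finset ι) (c : ι → F) (y : ι → RatFunc F) :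
    (carlitzE F d).eval (∑ j ∈ s, c j • y j) = ∑ j ∈ s, c j • (carlitzE F d).eval (y j) := by
  simp only [eval_carlitzE, map_sum, map_smul, Finset.mul_sum, Finset.smul_sum, mul_smul_comm]
  rw [Finset.sum_comm]

/-- The difference multiplies the i-th term by θ^{q^i} - θ, which kills i = 0 and turns 1/D_{i+1}
into D_i^{-q}. -/
theorem eval_carlitzE_X_mul (d : ℕ) (y : RatFunc F) :
    (carlitzE F (d + 1)).eval (RatFunc.X * y) =
      RatFunc.X * (carlitzE F (d + 1)).eval y +
        (carlitzE F d).eval y ^ Fintype.card F := by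
  rw [← sub_eq_iff_eq_add', eval_carlitzE, eval_carlitzE, eval_carlitzE, Finset.mul_sum,
    ← Finset.sum_sub_distrib, sum_pow_q, Finset.sum_range_succ']
  have h0 : carlitzCoeff F (d + 1) 0 * frobPow F (RatFunc F) 0 (RatFunc.X * y) -
      RatFunc.X * (carlitzCoeff F (d + 1) 0 * frobPow F (RatFunc F) 0 y) = 0 := by
    simp only [frobPow_apply, pow_zero, pow_one]
    ring
  rw [h0, add_zero]
  refine Finset.sum_congr rfl fun i _ => ?_
  rw [carlitzCoeff, carlitzCoeff, mul_pow, mul_pow, ← sub_mul_inv_DK_succ]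
  simp only [frobPow_apply, mul_pow, Nat.add_sub_add_right, pow_succ, pow_mul]
  ring

/-- The value at 1 is a coefficient of e_C ∘ log_C; multiplication by θ then gives the other powers.
By linearity E_d reads off the coefficient of θ^d on polynomials of degree at most d. -/
theorem eval_carlitzE_X_pow {n d : ℕ} (h : n ≤ d) :
    (carlitzE F d).eval (RatFunc.X ^ n) = if n = d then 1 else 0 := by
  induction n generalizing d with
  | zero =>
    rw [eval_carlitzE]
    simp only [pow_zero, map_one, mul_one, carlitzCoeff]
    rw [sum_inv_DK_mul_inv_LK_pow]
    simp only [eq_comm]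
  | succ n ih =>
    obtain ⟨d, rfl⟩ : ∃ e, d = e + 1 := ⟨d - 1, by omega⟩
    rw [pow_succ', eval_carlitzE_X_mul, ih (by omega), ih (by omega), if_neg (by omega)]
    simp only [Nat.add_right_cancel_iff]
    split_ifs <;> simp [(q_pos F).ne']

theorem eval_carlitzE_algebraMap {d : ℕ} {a : F[X]} (h : a.natDegree ≤ d) :
    (carlitzE F d).eval (algebraMap F[X] (RatFunc F) a) = algebraMap F (RatFunc F) (a.coeff d) := by
  have e : algebraMap F[X] (RatFunc F) a =
      ∑ i ∈ Finset.range (d + 1), a.coeff i • (RatFunc.X : RatFunc F) ^ i := by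
    conv_lhs => rw [a.as_sum_range_C_mul_X_pow' (Nat.lt_succ_of_le h)]
    rw [map_sum]
    refine Finset.sum_congr rfl fun i _ => ?_
    rw [← Polynomial.smul_eq_C_mul, ← IsScalarTower.toAlgHom_apply F F[X] (RatFunc F), map_smul,
      IsScalarTower.toAlgHom_apply, map_pow,
      RatFunc.algebraMap_X]
  rw [e, eval_carlitzE_sum, Finset.sum_eq_single_of_mem d (by simp), eval_carlitzE_X_pow F le_rfl,
    if_pos rfl, Algebra.smul_def, mul_one]
  intro i hi hne
  rw [eval_carlitzE_X_pow F (Nat.lt_succ_iff.1 (Finset.mem_range.1 hi)), if_neg hne, smul_zero]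

theorem carlitzCoeff_self (d : ℕ) : carlitzCoeff F d d = (DK F d)⁻¹ := by
  simp [carlitzCoeff]

theorem coeff_carlitzE_sub_one (d : ℕ) :
    (carlitzE F d - 1).coeff (Fintype.card F ^ d) = (DK F d)⁻¹ := by
  have hd : Fintype.card F ^ d ≠ 0 := (pow_pos (q_pos F) d).ne'
  rw [Polynomial.coeff_sub, Polynomial.coeff_one, if_neg hd, sub_zero, carlitzE,
    Polynomial.finsetSum_coeff, Finset.sum_eq_single_of_mem d (by simp)]
  · rw [Polynomial.coeff_C_mul_X_pow, if_pos rfl, carlitzCoeff_self]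
  · intro i _ hne
    rw [Polynomial.coeff_C_mul_X_pow, if_neg]
    exact fun e => hne (Nat.pow_right_injective (one_lt_q F) e).symm

theorem natDegree_carlitzE_sub_one (d : ℕ) :
    (carlitzE F d - 1).natDegree = Fintype.card F ^ d := by
  refine Polynomial.natDegree_eq_of_le_of_coeff_ne_zero ?_ ?_
  · refine (Polynomial.natDegree_sub_le _ _).trans (max_le ?_ (by simp))
    refine Polynomial.natDegree_sum_le_of_forall_le _ _ fun i hi => ?_
    refine (Polynomial.natDegree_C_mul_X_pow_le _ _).trans ?_
    exact Nat.pow_le_pow_right (q_pos F) (Nat.lt_succ_iff.1 (Finset.mem_range.1 hi))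
  · rw [coeff_carlitzE_sub_one]
    exact inv_ne_zero (DK_ne_zero F d)

/-- The q^d monics of degree d are roots, and q^d is the degree, so they are all the roots, each
simple. -/
theorem carlitzE_sub_one_eq (d : ℕ) :
    carlitzE F d - 1 = Polynomial.C (DK F d)⁻¹ *
      ∏ a ∈ monics F d, (Polynomial.X - Polynomial.C (algebraMap F[X] (RatFunc F) a)) := by
  have hinj : Function.Injective (algebraMap F[X] (RatFunc F)) :=
    IsFractionRing.injective F[X] (RatFunc F)
  have h0 : carlitzE F d - 1 ≠ 0 := by
    intro h
    have := coeff_carlitzE_sub_one F d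
    rw [h, Polynomial.coeff_zero] at this
    exact inv_ne_zero (DK_ne_zero F d) this.symm
  have hroots : ((monics F d).map ⟨_, hinj⟩).val = (carlitzE F d - 1).roots := by
    refine Multiset.eq_of_le_of_card_le ?_ ?_
    · rw [Multiset.le_iff_subset (Finset.nodup _)]
      intro x hx
      rw [Finset.mem_val, Finset.mem_map] at hx
      obtain ⟨a, ha, rfl⟩ := hx
      obtain ⟨hm, hd⟩ := mem_monics.1 ha
      rw [Polynomial.mem_roots h0, Polynomial.IsRoot.def, Polynomial.eval_sub, Polynomial.eval_one]
      rw [Function.Embedding.coeFn_mk, eval_carlitzE_algebraMap F hd.le, ← hd]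
      rw [Polynomial.coeff_natDegree, hm.leadingCoeff, map_one, sub_self]
    · refine (Polynomial.card_roots' _).trans ?_
      rw [natDegree_carlitzE_sub_one, Finset.card_val, Finset.card_map, card_monics]
  have h1 := Polynomial.C_leadingCoeff_mul_prod_multiset_X_sub_C (p := carlitzE F d - 1) (by
    rw [← hroots, natDegree_carlitzE_sub_one, Finset.card_val, Finset.card_map, card_monics])
  rw [← hroots, Polynomial.leadingCoeff, natDegree_carlitzE_sub_one, coeff_carlitzE_sub_one] at h1
  rw [← h1, ← Finset.prod_eq_multiset_prod, Finset.prod_map]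
  rfl

theorem derivative_carlitzE (d : ℕ) :
    Polynomial.derivative (carlitzE F d) = Polynomial.C (LK F d)⁻¹ := by
  have hq : (Fintype.card F : RatFunc F) = 0 := by
    rw [← map_natCast (algebraMap F (RatFunc F)), FiniteField.cast_card_eq_zero, map_zero]
  rw [carlitzE, Polynomial.derivative_sum, Finset.sum_eq_single_of_mem 0 (by simp)]
  · simp [carlitzCoeff]
  · intro i _ hi
    rw [Polynomial.derivative_C_mul_X_pow, Nat.cast_pow, hq, zero_pow hi, mul_zero, map_zero,
      zero_mul]

theorem mk_inv_pow_mul {K : Type*} [Field K] {a : K} (ha : a ≠ 0) :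
    (PowerSeries.mk fun n => (a ^ (n + 1))⁻¹) * (PowerSeries.X - PowerSeries.C a) = -1 := by
  ext n
  rw [mul_sub, map_sub, PowerSeries.coeff_mul_C, PowerSeries.coeff_mk, map_neg,
    PowerSeries.coeff_one]
  rcases n with _ | n
  · simp [ha]
  · rw [PowerSeries.coeff_succ_mul_X, PowerSeries.coeff_mk, if_neg (Nat.succ_ne_zero n)]
    field_simp
    ring

/-- Logarithmic derivative of E_d - 1: the sum of 1/(x - a) over its roots is E_d'/(E_d - 1) with
constant numerator 1/L_d, and expanding 1/(a - x) geometrically produces the power sums. -/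
theorem mk_powerSum_mul (d : ℕ) :
    (PowerSeries.mk fun n => powerSum F d (n + 1)) * ((carlitzE F d - 1 : (RatFunc F)[X]) :
      (RatFunc F)⟦X⟧) = -PowerSeries.C (LK F d)⁻¹ := by
  classical
  have h1 : (PowerSeries.mk fun n => powerSum F d (n + 1)) = ∑ a ∈ monics F d,
      PowerSeries.mk fun n => (algebraMap F[X] (RatFunc F) a ^ (n + 1))⁻¹ := by
    ext n
    simp [powerSum]
  have h2 : Polynomial.derivative (carlitzE F d - 1) = Polynomial.C (DK F d)⁻¹ *
      ∑ a ∈ monics F d, ∏ b ∈ (monics F d).erase a,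
        (Polynomial.X - Polynomial.C (algebraMap F[X] (RatFunc F) b)) := by
    rw [carlitzE_sub_one_eq, Polynomial.derivative_C_mul, Polynomial.derivative_prod_finset]
    simp
  rw [Polynomial.derivative_sub, derivative_carlitzE, Polynomial.derivative_one, sub_zero] at h2
  rw [h1, Finset.sum_mul, ← Polynomial.coe_C, h2, Finset.mul_sum]
  rw [← Polynomial.coeToPowerSeries.ringHom_apply, ← Polynomial.coeToPowerSeries.ringHom_apply,
    map_sum, ← Finset.sum_neg_distrib]
  refine Finset.sum_congr rfl fun a ha => ?_
  have ha0 : algebraMap F[X] (RatFunc F) a ≠ 0 := by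
    simpa using (mem_monics.1 ha).1.ne_zero
  rw [carlitzE_sub_one_eq, ← Finset.mul_prod_erase _ _ ha, mul_left_comm, map_mul,
    Polynomial.coeToPowerSeries.ringHom_apply (φ := _ - _), Polynomial.coe_sub, Polynomial.coe_X,
    Polynomial.coe_C, ← mul_assoc, mk_inv_pow_mul ha0, neg_one_mul]

theorem powerSum_eq (d n : ℕ) :
    powerSum F d (n + 1) = (if n = 0 then (LK F d)⁻¹ else 0) +
      ∑ i ∈ Finset.range (d + 1), if Fintype.card F ^ i ≤ n then
        carlitzCoeff F d i * powerSum F d (n - Fintype.card F ^ i + 1) else 0 := by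
  have h := congrArg (PowerSeries.coeff n) (mk_powerSum_mul F d)
  rw [Polynomial.coe_sub, Polynomial.coe_one, mul_sub, mul_one, map_sub, PowerSeries.coeff_mk,
    map_neg, PowerSeries.coeff_C, carlitzE, ← Polynomial.coeToPowerSeries.ringHom_apply, map_sum,
    Finset.mul_sum, map_sum] at h
  have h1 : ∀ i ∈ Finset.range (d + 1), PowerSeries.coeff n
      ((PowerSeries.mk fun n => powerSum F d (n + 1)) * Polynomial.coeToPowerSeries.ringHom
        (Polynomial.C (carlitzCoeff F d i) * Polynomial.X ^ Fintype.card F ^ i)) =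
      if Fintype.card F ^ i ≤ n then
        carlitzCoeff F d i * powerSum F d (n - Fintype.card F ^ i + 1) else 0 := by
    intro i _
    rw [Polynomial.coeToPowerSeries.ringHom_apply, Polynomial.coe_mul, Polynomial.coe_C,
      Polynomial.coe_pow, Polynomial.coe_X, mul_left_comm, PowerSeries.coeff_C_mul,
      PowerSeries.coeff_mul_X_pow']
    split_ifs <;> simp
  rw [Finset.sum_congr rfl h1] at h
  linear_combination -h

theorem L_add (e i : ℕ) :
    L F (e + i) = (∏ j ∈ Finset.Icc 1 i,
      (Polynomial.X - Polynomial.X ^ Fintype.card F ^ (j + e))) * L F e := by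
  induction i with
  | zero => simp
  | succ i ih =>
    rw [← add_assoc, L_succ, ih, Finset.prod_Icc_succ_top (by omega),
      show e + i + 1 = i + 1 + e by omega]
    ring

/-- Specialising the `i`-th coefficient of the Anderson-Thakur generating series at `t = θ`,
`θ = θ ^ (q ^ d)` gives the `i`-th coefficient of `E_d(L_d x)`. -/
theorem prod_div_DK_eq (d i : ℕ) :
    (∏ j ∈ Finset.Icc 1 i, ((RatFunc.X : RatFunc F) ^ Fintype.card F ^ i -
      RatFunc.X ^ Fintype.card F ^ (j + d))) * (DK F i)⁻¹ =
      if i ≤ d then carlitzCoeff F d i * LK F d ^ Fintype.card F ^ i else 0 := by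
  split_ifs with h
  · obtain ⟨e, rfl⟩ : ∃ e, d = e + i := ⟨d - i, by omega⟩
    have h1 : LK F (e + i) = (∏ j ∈ Finset.Icc 1 i,
        ((RatFunc.X : RatFunc F) - RatFunc.X ^ Fintype.card F ^ (j + e))) * LK F e := by
      simp [LK, L_add]
    have h2 : ∀ j ∈ Finset.Icc 1 i, ((RatFunc.X : RatFunc F) -
        RatFunc.X ^ Fintype.card F ^ (j + e)) ^ Fintype.card F ^ i =
        (RatFunc.X : RatFunc F) ^ Fintype.card F ^ i -
          RatFunc.X ^ Fintype.card F ^ (j + (e + i)) := by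
      intro j _
      rw [sub_pow_q_pow, ← pow_mul, ← pow_add, add_assoc]
    have h3 := LK_ne_zero F e
    rw [h1, mul_pow, ← Finset.prod_pow, Finset.prod_congr rfl h2, carlitzCoeff,
      Nat.add_sub_cancel, inv_pow]
    field_simp
  -- For i > d the factor j = i - d is θ^{q^i} - θ^{q^i}.
  · rw [Finset.prod_eq_zero (i := i - d), zero_mul]
    · exact Finset.mem_Icc.2 (by omega)
    · rw [Nat.sub_add_cancel (by omega), sub_self]

/-- Rescaling x by L_d turns the recursion for power sums into the specialised recursion of the
Anderson–Thakur series. -/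
theorem LK_pow_mul_powerSum_eq (d n : ℕ) :
    LK F d ^ (n + 1) * powerSum F d (n + 1) = (if n = 0 then 1 else 0) +
      ∑ i ∈ Finset.range (n + 1), if Fintype.card F ^ i ≤ n then
        ((∏ j ∈ Finset.Icc 1 i, ((RatFunc.X : RatFunc F) ^ Fintype.card F ^ i -
          RatFunc.X ^ Fintype.card F ^ (j + d))) * (DK F i)⁻¹) *
        (LK F d ^ (n - Fintype.card F ^ i + 1) * powerSum F d (n - Fintype.card F ^ i + 1))
        else 0 := by
  have h0 := LK_ne_zero F d
  rw [powerSum_eq, mul_add]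
  congr 1
  · split_ifs with h
    · simp [h, h0]
    · simp
  · rw [Finset.mul_sum]
    have h1 : ∀ i, LK F d ^ (n + 1) * (if Fintype.card F ^ i ≤ n then
        carlitzCoeff F d i * powerSum F d (n - Fintype.card F ^ i + 1) else 0) =
        if Fintype.card F ^ i ≤ n then carlitzCoeff F d i * LK F d ^ Fintype.card F ^ i *
          (LK F d ^ (n - Fintype.card F ^ i + 1) * powerSum F d (n - Fintype.card F ^ i + 1))
        else 0 := by
      intro i
      split_ifs with h
      · rw [show n + 1 = Fintype.card F ^ i + (n - Fintype.card F ^ i + 1) by omega, pow_add]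
        ring
      · rw [mul_zero]
    have h2 : ∀ i, n + 1 ≤ i → ¬ Fintype.card F ^ i ≤ n := by
      intro i hi
      have := Nat.lt_pow_self (n := i) (one_lt_q F)
      omega
    simp only [h1, prod_div_DK_eq]
    -- One recursion runs over i ≤ d, the other over i ≤ n. Both extend to the larger range: q^i > n
    -- when i > n, and the coefficient vanishes when i > d.
    rw [Finset.sum_subset (Finset.range_subset_range.2 (le_max_right (d + 1) (n + 1))) fun i _ hi =>
        if_neg (h2 i (by simpa using hi)),
      ← Finset.sum_subset (Finset.range_subset_range.2 (le_max_left (d + 1) (n + 1))) fun i _ hi => by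
        rw [if_neg (c := i ≤ d) (by simpa using hi), zero_mul, ite_self]]
    refine Finset.sum_congr rfl fun i hi => ?_
    rw [if_pos (c := i ≤ d) (by simpa [Nat.lt_succ_iff] using hi)]

end PowerSums

/-! ### Anderson–Thakur polynomials and their specialisation -/

section AndersonThakur

variable (F : Type*) [Field F] [Fintype F]

theorem coeff_mul_frobSeries {K : Type*} [Field K] (g : K⟦X⟧) (c : ℕ → K) (n : ℕ) :
    PowerSeries.coeff n (g * frobSeries F c) =
      ∑ i ∈ Finset.range (n + 1), if Fintype.card F ^ i ≤ n then
        c i * PowerSeries.coeff (n - Fintype.card F ^ i) g else 0 := by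
  rw [mul_comm, PowerSeries.coeff_mul, Finset.Nat.sum_antidiagonal_eq_sum_range_succ_mk]
  have h1 : ∀ k ∈ Finset.range n.succ, PowerSeries.coeff k (frobSeries F c) *
      PowerSeries.coeff (n - k) g = ∑ i ∈ Finset.range (n + 1),
        if k = Fintype.card F ^ i then c i * PowerSeries.coeff (n - k) g else 0 := by
    intro k hk
    rw [frobSeries, PowerSeries.coeff_mk, Finset.sum_mul]
    simp only [ite_mul, zero_mul]
    refine Finset.sum_subset (Finset.range_subset_range.2
      (Nat.succ_le_of_lt (Finset.mem_range.1 hk))) fun i _ hi => if_neg ?_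
    have := Nat.lt_pow_self (n := i) (one_lt_q F)
    have := Finset.mem_range.not.1 hi
    omega
  rw [Finset.sum_congr rfl h1, Finset.sum_comm]
  refine Finset.sum_congr rfl fun i _ => ?_
  rw [Finset.sum_ite_eq']
  simp only [Finset.mem_range, Nat.lt_succ_iff]

/-- The numerator `∏_{j=1}^{i} (t ^ (q ^ i) - θ ^ (q ^ j))`. -/
def atNum (i : ℕ) : F[X][X] :=
  ∏ j ∈ Finset.Icc 1 i,
    ((Polynomial.X : F[X][X]) ^ (Fintype.card F ^ i) -
      Polynomial.C (Polynomial.X ^ (Fintype.card F ^ j)))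

/-- Coefficientwise form of (1 - S)⁻¹ = 1 + (1 - S)⁻¹ S. -/
theorem atCoeff_eq (n : ℕ) :
    atCoeff F n = (if n = 0 then 1 else 0) +
      ∑ i ∈ Finset.range (n + 1), if Fintype.card F ^ i ≤ n then
        algebraMap F[X][X] (FractionRing F[X][X]) (atNum F i) /
          algebraMap F[X][X] (FractionRing F[X][X]) ((D F i).map Polynomial.C) *
        atCoeff F (n - Fintype.card F ^ i) else 0 := by
  set S : (FractionRing F[X][X])⟦X⟧ := frobSeries F fun i =>
    algebraMap F[X][X] (FractionRing F[X][X]) (atNum F i) /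
      algebraMap F[X][X] (FractionRing F[X][X]) ((D F i).map Polynomial.C) with hS
  have h0 : PowerSeries.constantCoeff (1 - S) ≠ 0 := by
    rw [map_sub, map_one, hS, constantCoeff_frobSeries, sub_zero]
    exact one_ne_zero
  have h1 : ∀ m, atCoeff F m = PowerSeries.coeff m (1 - S)⁻¹ := fun m => rfl
  simp only [h1]
  rw [← coeff_mul_frobSeries F, ← hS, ← PowerSeries.coeff_one, ← map_add]
  congr 1
  linear_combination PowerSeries.inv_mul_cancel (1 - S) h0

/-- The Anderson-Thakur polynomials, defined by the recursion that the generating series gives. -/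
def atPoly (n : ℕ) : F[X][X] :=
  (if n = 0 then 1 else 0) + ∑ i ∈ Finset.range (n + 1),
    if Fintype.card F ^ i ≤ n then
      have : 0 < Fintype.card F ^ i := pow_pos (q_pos F) i
      -- This Euclidean quotient is exact, by `D_mul_factorial_dvd`.
      (factorial F n / (D F i * factorial F (n - Fintype.card F ^ i))).map Polynomial.C *
        atNum F i * atPoly (n - Fintype.card F ^ i) else 0
termination_by n
decreasing_by omega

theorem D_mul_factorial_mul_div {n i : ℕ} (h : Fintype.card F ^ i ≤ n) :
    D F i * factorial F (n - Fintype.card F ^ i) *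
      (factorial F n / (D F i * factorial F (n - Fintype.card F ^ i))) = factorial F n := by
  have h1 := D_mul_factorial_dvd F (n - Fintype.card F ^ i) i
  rw [Nat.sub_add_cancel h] at h1
  exact EuclideanDomain.mul_div_cancel' (mul_ne_zero (D_ne_zero F i) (factorial_ne_zero F _)) h1

theorem factorial_zero : factorial F 0 = 1 := by simp [factorial]

omit [Fintype F] in
theorem algebraMap_map_C_ne_zero {p : F[X]} (hp : p ≠ 0) :
    algebraMap F[X][X] (FractionRing F[X][X]) (p.map Polynomial.C) ≠ 0 := by
  rw [Ne, IsFractionRing.to_map_eq_zero_iff,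
    Polynomial.map_eq_zero_iff Polynomial.C_injective]
  exact hp

theorem algebraMap_atPoly (n : ℕ) :
    algebraMap F[X][X] (FractionRing F[X][X]) (atPoly F n) =
      algebraMap F[X][X] (FractionRing F[X][X]) ((factorial F n).map Polynomial.C) *
        atCoeff F n := by
  induction n using Nat.strong_induction_on with
  | _ n ih =>
  rw [atPoly, atCoeff_eq, map_add, map_sum, mul_add, Finset.mul_sum]
  congr 1
  · split_ifs with h
    · simp [h, factorial_zero]
    · simp
  · refine Finset.sum_congr rfl fun i _ => ?_
    split_ifs with h
    · have h1 := pow_pos (q_pos F) i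
      have h2 := algebraMap_map_C_ne_zero F (D_ne_zero F i)
      rw [map_mul, map_mul, ih _ (by omega)]
      nth_rewrite 2 [← D_mul_factorial_mul_div F h]
      rw [Polynomial.map_mul, Polynomial.map_mul, map_mul, map_mul]
      field_simp
    · simp

/-- `atPoly` witnesses the existence required by `H`, and a polynomial is determined by its image in
the fraction field. -/
theorem H_eq_atPoly (n : ℕ) : H F n = atPoly F n := by
  have h0 : algebraMap F[X][X] (FractionRing F[X][X])
      ((Gamma F (n + 1)).map Polynomial.C) ≠ 0 :=
    algebraMap_map_C_ne_zero F (factorial_ne_zero F n)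
  have hex : ∃ p : F[X][X],
      algebraMap F[X][X] (FractionRing F[X][X]) p /
        algebraMap F[X][X] (FractionRing F[X][X]) ((Gamma F (n + 1)).map Polynomial.C) =
      atCoeff F n :=
    ⟨atPoly F n, by rw [div_eq_iff h0, algebraMap_atPoly, mul_comm]; rfl⟩
  have h1 : H F n = hex.choose := dif_pos hex
  apply IsFractionRing.injective F[X][X] (FractionRing F[X][X])
  rw [h1, (div_eq_iff h0).1 hex.choose_spec, algebraMap_atPoly, mul_comm]
  rfl

/-- The specialisation `t ↦ θ`, `a ↦ a ^ (q ^ d)` for `a ∈ A`. -/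
def twistEval (d : ℕ) : F[X][X] →+* RatFunc F :=
  Polynomial.eval₂RingHom
    ((algebraMap F[X] (RatFunc F)).comp (frobPow F F[X] d : F[X] →+* F[X])) RatFunc.X

theorem twistEval_X (d : ℕ) : twistEval F d Polynomial.X = RatFunc.X := by
  simp [twistEval]

theorem twistEval_C (d : ℕ) (a : F[X]) :
    twistEval F d (Polynomial.C a) = algebraMap F[X] (RatFunc F) a ^ Fintype.card F ^ d := by
  simp [twistEval, frobPow_apply]

/-- The twist acts on θ but fixes the constants in F, so factorials written in t specialise to
themselves, untwisted. -/
theorem twistEval_map_C (d : ℕ) (a : F[X]) :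
    twistEval F d (a.map Polynomial.C) = algebraMap F[X] (RatFunc F) a := by
  have h : (twistEval F d).comp (Polynomial.mapRingHom Polynomial.C) =
      algebraMap F[X] (RatFunc F) := by
    ext x
    · simp [twistEval_C, ← map_pow, FiniteField.pow_card_pow]
    · simp [twistEval_X]
  exact DFunLike.congr_fun h a

theorem twistEval_atNum (d i : ℕ) :
    twistEval F d (atNum F i) = ∏ j ∈ Finset.Icc 1 i,
      ((RatFunc.X : RatFunc F) ^ Fintype.card F ^ i - RatFunc.X ^ Fintype.card F ^ (j + d)) := by
  rw [atNum, map_prod]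
  refine Finset.prod_congr rfl fun j _ => ?_
  rw [map_sub, map_pow, twistEval_X, twistEval_C, map_pow, RatFunc.algebraMap_X, ← pow_mul,
    ← pow_add]

/-- Both sides satisfy the same recursion, so strong induction on n suffices. -/
theorem twistEval_atPoly (d n : ℕ) :
    twistEval F d (atPoly F n) =
      algebraMap F[X] (RatFunc F) (factorial F n) *
        (LK F d ^ (n + 1) * powerSum F d (n + 1)) := by
  induction n using Nat.strong_induction_on with
  | _ n ih =>
  rw [atPoly, LK_pow_mul_powerSum_eq, map_add, map_sum, mul_add, Finset.mul_sum]
  congr 1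
  · split_ifs with h
    · simp [h, factorial_zero]
    · simp
  · refine Finset.sum_congr rfl fun i _ => ?_
    split_ifs with h
    · have h1 := pow_pos (q_pos F) i
      have h2 := DK_ne_zero F i
      rw [map_mul, map_mul, ih _ (by omega), twistEval_map_C, twistEval_atNum]
      nth_rewrite 2 [← D_mul_factorial_mul_div F h]
      rw [map_mul, map_mul, ← DK]
      field_simp
    · simp

/-- The Anderson-Thakur interpolation formula for power sums. -/
theorem sum_X_pow_mul_u_pow {r : ℕ} (s : Fin r → ℕ) (l : Fin r) (hs : 0 < s l) (d : ℕ) :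
    ∑ j ∈ Finset.range ((H F (s l - 1)).natDegree + 1),
      (RatFunc.X : RatFunc F) ^ j *
        algebraMap F[X] (RatFunc F) (u s l j) ^ Fintype.card F ^ d =
      algebraMap F[X] (RatFunc F) (Gamma F (s l)) * (LK F d ^ s l * powerSum F d (s l)) := by
  have h := twistEval_atPoly F d (s l - 1)
  rw [← H_eq_atPoly, Nat.sub_add_cancel hs] at h
  rw [Gamma, ← h, twistEval, Polynomial.coe_eval₂RingHom, Polynomial.eval₂_eq_sum_range]
  refine Finset.sum_congr rfl fun j _ => ?_
  simp [u, frobPow_apply, mul_comm]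

end AndersonThakur

/-! ### Truncated zeta values and the comparison -/

section Main

variable {F : Type*} [Field F] [Fintype F]

theorem powerSum_one (d : ℕ) : powerSum F d 1 = (LK F d)⁻¹ := by
  rw [← zero_add 1, powerSum_eq, if_pos rfl, Finset.sum_eq_zero, add_zero]
  intro i _
  exact if_neg (not_le.2 (pow_pos (q_pos F) i))

omit [Fintype F] in
theorem hasResidue_sum {ι : Type*} {P : F[X]} (hP : Irreducible P) (S : Finset ι)
    {x : ι → RatFunc F} {y : ι → F[X] ⧸ Ideal.span {P}} (h : ∀ i ∈ S, HasResidue P (x i) (y i)) :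
    HasResidue P (∑ i ∈ S, x i) (∑ i ∈ S, y i) := by
  classical
  induction S using Finset.induction_on with
  | empty => exact ⟨0, 1, fun h => hP.not_isUnit (isUnit_of_dvd_one h), by simp, by simp⟩
  | insert i S hi ih =>
    rw [Finset.sum_insert hi, Finset.sum_insert hi]
    obtain ⟨a, b, hb, hx, hy⟩ := h i (Finset.mem_insert_self i S)
    obtain ⟨a', b', hb', hx', hy'⟩ := ih fun j hj => h j (Finset.mem_insert_of_mem hj)
    have h0 : algebraMap F[X] (RatFunc F) b ≠ 0 := by
      simpa using fun e : b = 0 => hb (e ▸ dvd_zero P)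
    have h0' : algebraMap F[X] (RatFunc F) b' ≠ 0 := by
      simpa using fun e : b' = 0 => hb' (e ▸ dvd_zero P)
    refine ⟨a * b' + b * a', b * b', fun hd => (hP.prime.dvd_or_dvd hd).elim hb hb', ?_, ?_⟩
    · rw [hx, hx', div_add_div _ _ h0 h0']
      simp
    · simp only [map_add, map_mul, ← hy, ← hy']
      ring

omit [Fintype F] in
theorem hasResidue_inv {P : F[X]} (hP : Irreducible P) {b : F[X]} (hb : ¬ P ∣ b) :
    HasResidue P (algebraMap F[X] (RatFunc F) b)⁻¹
      (Ring.inverse (Ideal.Quotient.mk (Ideal.span {P}) b)) := by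
  have : (Ideal.span {P}).IsMaximal := PrincipalIdealRing.isMaximal_of_irreducible hP
  have h0 : Ideal.Quotient.mk (Ideal.span {P}) b ≠ 0 := by
    rwa [Ne, Ideal.Quotient.eq_zero_iff_mem, Ideal.mem_span_singleton]
  obtain ⟨c, hc⟩ := Ideal.Quotient.exists_inv h0
  exact ⟨1, b, hb, by simp, by rw [Ring.inverse_mul_cancel _ (.of_mul_eq_one _ hc), map_one]⟩

/-- The truncated multiple zeta value `∑_{N > i_1 > ⋯ > i_n ≥ 0} S_{i_1}(s_1) ⋯ S_{i_n}(s_n)`. -/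
def truncMZV {n : ℕ} (s : Fin n → ℕ) (N : ℕ) : RatFunc F :=
  ∑ i ∈ decTuples n 0 N, ∏ l, powerSum F (i l) (s l)

theorem truncMZV_eq_sum_monicTuples {n : ℕ} (s : Fin n → ℕ) (P : F[X]) :
    truncMZV s P.natDegree = ∑ a ∈ (finite_monicTuples n P).toFinset,
      (algebraMap F[X] (RatFunc F) (∏ i, a i ^ s i))⁻¹ := by
  rw [truncMZV, ← Finset.sum_fiberwise_of_maps_to
    (s := (finite_monicTuples n P).toFinset) (t := decTuples n 0 P.natDegree) (g := fun a l => (a l).natDegree)]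
  · refine Finset.sum_congr rfl fun i hi => ?_
    obtain ⟨hi1, hi2⟩ := mem_decTuples.1 hi
    simp only [powerSum]
    rw [Finset.prod_univ_sum]
    refine Finset.sum_congr ?_ fun a _ => by simp
    ext a
    rw [Fintype.mem_piFinset, Finset.mem_filter, Set.Finite.mem_toFinset]
    simp only [mem_monics, monicTuples, Set.mem_ofPred_eq, funext_iff]
    constructor
    · intro h
      have e : (fun l => (a l).natDegree) = i := funext fun l => (h l).2
      exact ⟨⟨fun l => ⟨(h l).1, (h l).2 ▸ (hi1 l).2⟩, e ▸ hi2⟩, fun l => (h l).2⟩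
    · exact fun h l => ⟨(h.1.1 l).1, h.2 l⟩
  · intro a ha
    rw [Set.Finite.mem_toFinset] at ha
    exact mem_decTuples.2 ⟨fun l => ⟨Nat.zero_le _, (ha.1 l).2⟩, ha.2⟩

/-- A prime dividing a denominator divides some monic a_l, which is impossible when deg a_l < deg P.
-/
theorem hasResidue_truncMZV {n : ℕ} (s : Fin n → ℕ) {P : F[X]} (hP : Irreducible P) :
    HasResidue P (truncMZV s P.natDegree) (finiteMZV s P) := by
  rw [truncMZV_eq_sum_monicTuples, finiteMZV,
    finsum_mem_eq_finite_toFinset_sum _ (finite_monicTuples n P)]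
  refine hasResidue_sum hP _ fun a ha => hasResidue_inv hP fun hd => ?_
  rw [Set.Finite.mem_toFinset] at ha
  obtain ⟨l, _, hl⟩ := hP.prime.exists_mem_finset_dvd hd
  have h1 := hP.prime.dvd_of_dvd_pow hl
  exact absurd (Polynomial.natDegree_le_of_dvd h1 (ha.1 l).1.ne_zero) (not_le.2 (ha.1 l).2)

variable {r : ℕ}

/-- The sum over the box J factors over l, and each factor is the interpolation formula
`sum_X_pow_mul_u_pow`. -/
theorem sum_X_pow_mul_prod (s : Fin r → ℕ) (hs : ∀ l, 0 < s l) (i : Fin r → ℕ) :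
    ∑ j ∈ J F s, (RatFunc.X : RatFunc F) ^ (∑ l, j l) * ∏ l,
        (algebraMap F[X] (RatFunc F) (u s l (j l)) ^ Fintype.card F ^ i l *
          (LK F (i l) ^ s l)⁻¹) =
      algebraMap F[X] (RatFunc F) (∏ l, Gamma F (s l)) * ∏ l, powerSum F (i l) (s l) := by
  have h1 : ∀ l, ∑ j ∈ Finset.range ((H F (s l - 1)).natDegree + 1),
      (RatFunc.X : RatFunc F) ^ j *
        (algebraMap F[X] (RatFunc F) (u s l j) ^ Fintype.card F ^ i l * (LK F (i l) ^ s l)⁻¹) =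
      algebraMap F[X] (RatFunc F) (Gamma F (s l)) * powerSum F (i l) (s l) := by
    intro l
    have h2 := LK_ne_zero F (i l)
    simp only [← mul_assoc]
    rw [← Finset.sum_mul, sum_X_pow_mul_u_pow F s l (hs l)]
    field_simp
  rw [map_prod, ← Finset.prod_mul_distrib, ← Finset.prod_congr rfl fun l _ => h1 l,
    Finset.prod_univ_sum, J]
  refine Finset.sum_congr rfl fun j _ => ?_
  rw [← Finset.prod_pow_eq_pow_sum, ← Finset.prod_mul_distrib]

/-- The weights c and exponents m are left arbitrary so that both assertions of the theorem are
instances. -/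
theorem sum_multiBC_div_BC_eq {ι : Type*} (hr : 0 < r) (s : Fin r → ℕ) (hs : ∀ l, 0 < s l)
    (S : Finset ι) (c : ι → RatFunc F) (m : ι → ℕ) :
    (algebraMap F[X] (RatFunc F) (∏ i, Gamma F (s i)))⁻¹ *
        ∑ j ∈ J F s, (RatFunc.X : RatFunc F) ^ (∑ l, j l) *
          ∑ i ∈ S, c i * (multiBC s j (Fintype.card F ^ m i - 1) /
            BC F (Fintype.card F ^ m i - 1)) =
      ∑ i ∈ S, c i * (LK F (m i) * ∑ k ∈ headTuples hr (m i), ∏ l, powerSum F (k l) (s l)) := by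
  have h0 : algebraMap F[X] (RatFunc F) (∏ i, Gamma F (s i)) ≠ 0 := by
    rw [Ne, FaithfulSMul.algebraMap_eq_zero_iff, Finset.prod_eq_zero_iff]
    rintro ⟨l, _, hl⟩
    exact factorial_ne_zero F _ hl
  rw [inv_mul_eq_iff_eq_mul₀ h0]
  simp only [multiBC_div_BC hr, Finset.mul_sum]
  rw [Finset.sum_comm]
  refine Finset.sum_congr rfl fun i _ => ?_
  rw [Finset.sum_comm]
  refine Finset.sum_congr rfl fun k _ => ?_
  rw [mul_left_comm, mul_left_comm (algebraMap _ _ _), ← sum_X_pow_mul_prod s hs, Finset.mul_sum,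
    Finset.mul_sum]
  exact Finset.sum_congr rfl fun j _ => by ring

theorem le_of_strictAnti {i : Fin r → ℕ} (hi : StrictAnti i) {k : ℕ} {l : Fin r}
    (h : l + k + 1 = r) : k ≤ i l := by
  induction k generalizing l with
  | zero => exact Nat.zero_le _
  | succ k ih =>
    have h1 := ih (l := ⟨l + 1, by omega⟩) (by simp only; omega)
    have h2 : i ⟨l + 1, by omega⟩ < i l := hi (Fin.lt_def.2 (Nat.lt_succ_self _))
    omega

theorem sub_one_le_head (hr : 0 < r) {i : Fin r → ℕ} (hi : StrictAnti i) :
    r - 1 ≤ i ⟨0, hr⟩ :=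
  le_of_strictAnti hi (by simp only; omega)

/-- Sorting by first entry; starting at r - 1 loses nothing, since r strictly decreasing naturals
begin at r - 1 or above. -/
theorem sum_headTuples_eq_truncMZV (hr : 0 < r) (s : Fin r → ℕ) (N : ℕ) :
    ∑ m ∈ Finset.Ico (r - 1) N, ∑ k ∈ headTuples hr m, ∏ l, powerSum F (k l) (s l) =
      truncMZV s N := by
  rw [truncMZV, ← Finset.sum_fiberwise_of_maps_to (s := decTuples r 0 N) (t := Finset.Ico (r - 1) N)
    (g := fun i => i ⟨0, hr⟩)]
  · refine Finset.sum_congr rfl fun m hm => Finset.sum_congr ?_ fun _ _ => rfl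
    ext i
    rw [mem_headTuples, Finset.mem_filter, mem_decTuples]
    refine ⟨fun h => ⟨⟨fun l => ⟨Nat.zero_le _, ?_⟩, h.1⟩, h.2⟩, fun h => ⟨h.1.2, h.2⟩⟩
    have : i l ≤ i ⟨0, hr⟩ := h.1.antitone (Fin.mk_le_of_le_val (Nat.zero_le _))
    have := Finset.mem_Ico.1 hm
    omega
  · intro i hi
    obtain ⟨h1, h2⟩ := mem_decTuples.1 hi
    exact Finset.mem_Ico.2 ⟨sub_one_le_head hr h2, (h1 _).2⟩

theorem strictAnti_append (hr : 0 < r) {d : ℕ} {i : Fin (d + 1) → ℕ} {k : Fin r → ℕ}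
    (hi : StrictAnti i) (hk : StrictAnti k) (h : k ⟨0, hr⟩ = i (Fin.last d)) :
    StrictAnti (Fin.append (fun l : Fin d => i l.castSucc) k) := by
  intro a b hab
  induction a using Fin.addCases with
  | left a =>
    induction b using Fin.addCases with
    | left b =>
      rw [Fin.append_left, Fin.append_left]
      exact hi (Fin.castSucc_lt_castSucc_iff.2 hab)
    | right b =>
      rw [Fin.append_left, Fin.append_right]
      have h1 : k b ≤ k ⟨0, hr⟩ := hk.antitone (Fin.mk_le_of_le_val (Nat.zero_le _))
      have h2 := hi (Fin.castSucc_lt_last a)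
      omega
  | right a =>
    induction b using Fin.addCases with
    | left b =>
      rw [Fin.lt_def, Fin.val_natAdd, Fin.val_castAdd] at hab
      omega
    | right b =>
      rw [Fin.append_right, Fin.append_right]
      refine hk ?_
      rw [Fin.lt_def, Fin.val_natAdd, Fin.val_natAdd] at hab
      rw [Fin.lt_def]
      omega

/-- L_{i_d} cancels its inverse, and each remaining 1/L_{i_l} is S_{i_l}(1). The entries i_0, …,
i_{d-1} are then glued to a tuple headed by i_d. -/
theorem sum_decTuples_eq_truncMZV (hr : 0 < r) (s : Fin r → ℕ) (N d : ℕ) :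
    ∑ i ∈ decTuples (d + 1) (r - 1) N, (∏ l, LK F (i l))⁻¹ *
        (LK F (i (Fin.last d)) *
          ∑ k ∈ headTuples hr (i (Fin.last d)), ∏ l, powerSum F (k l) (s l)) =
      truncMZV (Fin.append (fun _ : Fin d => 1) s) N := by
  have h1 : ∀ i : Fin (d + 1) → ℕ, (∏ l, LK F (i l))⁻¹ * (LK F (i (Fin.last d)) *
      ∑ k ∈ headTuples hr (i (Fin.last d)), ∏ l, powerSum F (k l) (s l)) =
      ∑ k ∈ headTuples hr (i (Fin.last d)),
        (∏ l : Fin d, powerSum F (i l.castSucc) 1) * ∏ l, powerSum F (k l) (s l) := by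
    intro i
    have h2 := LK_ne_zero F (i (Fin.last d))
    simp only [powerSum_one]
    rw [Fin.prod_univ_castSucc, ← Finset.mul_sum, mul_inv, Finset.prod_inv_distrib, mul_assoc,
      inv_mul_cancel_left₀ h2]
  simp only [h1]
  rw [Finset.sum_sigma', truncMZV]
  -- The entry i_d is dropped because it is also the head of the second block; the inverse recovers
  -- it by taking the first d + 1 entries, which overlap that block in one place.
  refine Finset.sum_nbij' (fun x => Fin.append (fun l : Fin d => x.1 l.castSucc) x.2)
    (fun k => ⟨fun l => k (Fin.castLE (by omega) l), fun l => k (Fin.natAdd d l)⟩) ?_ ?_ ?_ ?_ ?_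
  · rintro ⟨i, k⟩ hx
    obtain ⟨hi, hk⟩ := Finset.mem_sigma.1 hx
    obtain ⟨hi1, hi2⟩ := mem_decTuples.1 hi
    obtain ⟨hk1, hk2⟩ := mem_headTuples.1 hk
    refine mem_decTuples.2 ⟨fun l => ⟨Nat.zero_le _, ?_⟩, strictAnti_append hr hi2 hk1 hk2⟩
    induction l using Fin.addCases with
    | left l => simpa only [Fin.append_left] using (hi1 _).2
    | right l =>
      simp only [Fin.append_right]
      have h3 : k l ≤ k ⟨0, hr⟩ := hk1.antitone (Fin.mk_le_of_le_val (Nat.zero_le _))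
      exact (h3.trans hk2.le).trans_lt (hi1 (Fin.last d)).2
  · intro k hk
    obtain ⟨hk1, hk2⟩ := mem_decTuples.1 hk
    have h3 : StrictAnti fun l => k (Fin.natAdd d l) := fun a b hab =>
      hk2 (by rw [Fin.lt_def] at *; simpa using hab)
    have e : Fin.castLE (show d + 1 ≤ d + r by omega) (Fin.last d) = Fin.natAdd d ⟨0, hr⟩ := by
      ext; simp
    have h4 : StrictAnti fun l : Fin (d + 1) => k (Fin.castLE (by omega) l) := fun a b hab =>
      hk2 (by rw [Fin.lt_def] at *; simpa using hab)
    refine Finset.mem_sigma.2 ⟨mem_decTuples.2 ⟨fun l => ⟨?_, (hk1 _).2⟩, h4⟩,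
      mem_headTuples.2 ⟨h3, by simp only [e]⟩⟩
    have h5 := sub_one_le_head hr h3
    have h6 := h4.antitone (Fin.le_last l)
    simp only [e] at h6
    exact h5.trans h6
  · rintro ⟨i, k⟩ hx
    obtain ⟨-, hk⟩ := Finset.mem_sigma.1 hx
    obtain ⟨-, hk2⟩ := mem_headTuples.1 hk
    simp only [Fin.append_right, Sigma.mk.injEq, heq_eq_eq, and_true]
    funext l
    induction l using Fin.lastCases with
    | last =>
      have e : Fin.castLE (show d + 1 ≤ d + r by omega) (Fin.last d) = Fin.natAdd d ⟨0, hr⟩ := by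
        ext; simp
      rw [e, Fin.append_right]
      exact hk2
    | cast l => exact Fin.append_left _ _ l
  · intro k _
    funext l
    induction l using Fin.addCases with
    | left l => rw [Fin.append_left]; rfl
    | right l => rw [Fin.append_right]
  · rintro ⟨i, k⟩ _
    simp only [Fin.prod_univ_add, Fin.append_left, Fin.append_right]

end Main

end Carlitz

end

theorem mainTheorem3 {F : Type*} [Field F] [Fintype F] {r : ℕ} (hr : 0 < r)
    (s : Fin r → ℕ) (hs : ∀ i, 0 < s i)
    (P : F[X]) (hmonic : P.Monic) (hirr : Irreducible P)
    (hP : ¬ P ∣ ∏ i, Carlitz.Gamma F (s i)) :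
    Carlitz.HasResidue P
      ((algebraMap F[X] (RatFunc F) (∏ i, Carlitz.Gamma F (s i)))⁻¹ *
        ∑ j ∈ Carlitz.J F s, (RatFunc.X : RatFunc F) ^ (∑ l, j l) *
          ∑ i ∈ Finset.Ico (r - 1) P.natDegree,
            (algebraMap F[X] (RatFunc F) (Carlitz.L F i))⁻¹ *
              (Carlitz.multiBC s j (Fintype.card F ^ i - 1) /
                Carlitz.BC F (Fintype.card F ^ i - 1)))
      (Carlitz.finiteMZV s P) ∧
    ∀ d : ℕ, Carlitz.HasResidue P
      ((algebraMap F[X] (RatFunc F) (∏ i, Carlitz.Gamma F (s i)))⁻¹ *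
        ∑ j ∈ Carlitz.J F s, (RatFunc.X : RatFunc F) ^ (∑ l, j l) *
          ∑ i ∈ Carlitz.decTuples (d + 1) (r - 1) P.natDegree,
            (∏ l, algebraMap F[X] (RatFunc F) (Carlitz.L F (i l)))⁻¹ *
              (Carlitz.multiBC s j (Fintype.card F ^ i (Fin.last d) - 1) /
                Carlitz.BC F (Fintype.card F ^ i (Fin.last d) - 1)))
      (Carlitz.finiteMZV (Fin.append (fun _ : Fin d => 1) s) P) := by
  refine ⟨?_, fun d => ?_⟩
  · rw [Carlitz.sum_multiBC_div_BC_eq hr s hs _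
      (fun i => (algebraMap F[X] (RatFunc F) (Carlitz.L F i))⁻¹) fun i => i]
    have h : ∀ (m : ℕ) (x : RatFunc F),
        (algebraMap F[X] (RatFunc F) (Carlitz.L F m))⁻¹ * (Carlitz.LK F m * x) = x :=
      fun m x => inv_mul_cancel_left₀ (Carlitz.LK_ne_zero F m) x
    simp only [h]
    rw [Carlitz.sum_headTuples_eq_truncMZV]
    exact Carlitz.hasResidue_truncMZV s hirr
  · rw [Carlitz.sum_multiBC_div_BC_eq hr s hs _
      (fun i : Fin (d + 1) → ℕ => (∏ l, algebraMap F[X] (RatFunc F) (Carlitz.L F (i l)))⁻¹)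
      fun i => i (Fin.last d)]
    have h := Carlitz.sum_decTuples_eq_truncMZV (F := F) hr s P.natDegree d
    simp only [Carlitz.LK] at h ⊢
    rw [h]
    exact Carlitz.hasResidue_truncMZV _ hirr
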